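/- Let $n\ge 0$ be an integer and let $K\subset\mathbb{R}^n$ be a convex body, i.e. a compact convex set with non-empty interior. For $y\in K$ let $\|x\|_{K-y}=\inf\{t>0: x\in t(K-y)\}$. For real $p>-1$ set $\|0\|_{R_pK}=0$ and, for $x\in\mathbb{R}^n\setminus\{0\}$, $$\|x\|_{R_pK}=\begin{cases}\left(\dfrac{1}{\mathrm{Vol}_n(K)}\displaystyle\int_K\|x\|_{K-y}^{-p}\,dy\right)^{-1/p}, & p\neq 0,\\[2ex] \exp\left(\dfrac{1}{\mathrm{Vol}_n(K)}\displaystyle\int_K\log\|x\|_{K-y}\,dy\right), & p=0,\end{cases}$$ and let the radial $p$th mean body of $K$ be $R_pK=\{x\in\mathbb{R}^n:\|x\|_{R_pK}\le 1\}$. Then, for every real $p>-1$ (including $p\in(-1,0)$), the integrals above converge absolutely for all $x\neq 0$, the function $\|\cdot\|_{R_pK}$ is the Minkowski functional of $R_pK$, that is, $\|x\|_{R_pK}=\inf\{t>0:x\in tR_pK\}$ for all $x\in\mathbb{R}^n$, and $R_pK$ is a convex body symmetric about the origin. -/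

import Mathlib

open MeasureTheory

/-- A convex body: a compact convex set with non-empty interior. -/
structure IsConvexBody {n : ℕ} (K : Set (EuclideanSpace ℝ (Fin n))) : Prop where
  isCompact : IsCompact K
  convex : Convex ℝ K
  interior_nonempty : (interior K).Nonempty

/-- The Minkowski functional `‖x‖_{K - y} = inf {t > 0 : x ∈ t (K - y)}` of the translate `K - y`.
For a convex body `K` and `y` in its interior this is finite; the value `+∞` can occur only for `y`
on the boundary of `K`, a Lebesgue null set, where `gauge` takes the value `0` instead. -/
noncomputable def translateGauge {n : ℕ} (K : Set (EuclideanSpace ℝ (Fin n)))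
    (y x : EuclideanSpace ℝ (Fin n)) : ℝ :=
  gauge ((fun z => z - y) '' K) x

/-- The function integrated over `y ∈ K` in the definition of the radial `p`th mean body:
`‖x‖_{K - y} ^ (-p)` for `p ≠ 0` and `log ‖x‖_{K - y}` for `p = 0`. -/
noncomputable def radialMeanIntegrand {n : ℕ} (p : ℝ) (K : Set (EuclideanSpace ℝ (Fin n)))
    (x y : EuclideanSpace ℝ (Fin n)) : ℝ :=
  if p = 0 then Real.log (translateGauge K y x) else translateGauge K y x ^ (-p)

open Classical in
/-- The functional `x ↦ ‖x‖_{R_p K}` defining the radial `p`th mean body. At the origin the defining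
formula, read in `[0, ∞]`, gives `0`. -/
noncomputable def radialMeanFunctional {n : ℕ} (p : ℝ) (K : Set (EuclideanSpace ℝ (Fin n)))
    (x : EuclideanSpace ℝ (Fin n)) : ℝ :=
  if x = 0 then 0
  else if p = 0 then
    Real.exp ((∫ y in K, radialMeanIntegrand p K x y) / volume.real K)
  else
    ((∫ y in K, radialMeanIntegrand p K x y) / volume.real K) ^ (-(1 / p))

/-- The radial `p`th mean body `R_p K`, the unit ball of `x ↦ ‖x‖_{R_p K}`. -/
def radialMeanBody {n : ℕ} (p : ℝ) (K : Set (EuclideanSpace ℝ (Fin n))) :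
    Set (EuclideanSpace ℝ (Fin n)) :=
  {x | radialMeanFunctional p K x ≤ 1}

open Set ENNReal

/-! Put `q = -p < 1` and let `Y` be uniform on `K`. Then `‖x‖_{R_pK}` is the power mean of order `q`
of the random variable `‖x‖_{K-Y}`, and everything except the triangle inequality is soft. The event
`‖x‖_{K-Y} ≤ u` is, up to a null set, `Y + x/u ∈ K`, so the distribution function of `‖x‖_{K-Y}` at
`u` is `g(x/u)`, with `g` the normalised covariogram (`translateOverlap`). Prékopa–Leindler makes
`g` log-concave. Since `(x+y)/(u+v)` is the convex combination of `x/u` and `y/v` with weights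
`u/(u+v)` and `v/(u+v)`, the distribution functions of the gauges of `x`, `y`, `x+y` satisfy
`F₁(u)^(u/(u+v)) F₂(v)^(v/(u+v)) ≤ F₃(u+v)`.

The rest is one-dimensional (`powerMean_le_add`). For `q ≠ 0` the `q`th moment is an integral of
`u^(q-1) F(u)` or of `u^(q-1) (1 - F(u))`. Rescale the first two variables by `a` and `b`, `a + b =
1`, so that the weighted functions have equal suprema. Brunn–Minkowski on the line then compares
superlevel sets, and integration over the levels compares `a E(U/a)^q + b E(V/b)^q` with `E W^q`.
Convexity (`q < 0`) or concavity (`0 < q < 1`) of `t^q` turns this into the triangle inequality. The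
case `q = 0` is a limit.

Evenness of `g` gives symmetry. The diameter of `K` bounds the gauge below, which settles negative
moments; for `0 < q < 1`, log-concavity forces `1 - g(x/u) = O(1/u)`, so the moment is finite. -/

/-! ### Brunn–Minkowski and superlevel sets on the line -/

/-- One-dimensional Brunn–Minkowski inequality. -/
theorem volume_add_volume_le_of_add_mem {A B C : Set ℝ} (hA : MeasurableSet A)
    (hB : MeasurableSet B) (hAn : A.Nonempty) (hBn : B.Nonempty)
    (h : ∀ a ∈ A, ∀ b ∈ B, a + b ∈ C) : volume A + volume B ≤ volume C := by
  have compact_case : ∀ A' ⊆ A, ∀ B' ⊆ B, IsCompact A' → IsCompact B' → A'.Nonempty →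
      B'.Nonempty → volume A' + volume B' ≤ volume C := by
    intro A' hA' B' hB' cA cB nA nB
    obtain ⟨a, ha, ha_max⟩ := cA.exists_isGreatest nA
    obtain ⟨b, hb, hb_min⟩ := cB.exists_isLeast nB
    -- With `a = max A'` and `b = min B'`, the translates `A' + b` and `a + B'` lie in `C` on either
    -- side of `a + b` and share only that point.
    rw [← measure_inter_add_sdiff C (measurableSet_Iic (a := a + b))]
    refine add_le_add ?_ ?_
    · rw [← measure_preimage_add_right volume (-b) A']
      refine measure_mono fun x hx => ⟨?_, ?_⟩
      · simpa using h _ (hA' hx) _ (hB' hb)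
      · have := ha_max hx
        simp only [mem_Iic]
        linarith
    · rw [← measure_preimage_add_right volume (-a) B',
        ← measure_sdiff_null (measure_singleton (μ := volume) (a + b))]
      refine measure_mono fun x hx => ⟨?_, ?_⟩
      · simpa using h _ (hA' ha) _ (hB' hx.1)
      · have h1 : b ≤ x + -a := hb_min hx.1
        have h2 : x ≠ a + b := hx.2
        simp only [mem_Iic, not_le]
        exact lt_of_le_of_ne (by linarith) h2.symm
  obtain ⟨a, ha⟩ := hAn
  obtain ⟨b, hb⟩ := hBn
  -- The alternative `r = 0` covers null sets, where no `r < volume D` exists; adjoining `d` keeps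
  -- the compact set non-empty.
  have approx : ∀ D : Set ℝ, MeasurableSet D → ∀ d ∈ D, ∀ r, r = 0 ∨ r < volume D →
      ∃ D' ⊆ D, IsCompact D' ∧ D'.Nonempty ∧ r ≤ volume D' := by
    rintro D hD d hd r (rfl | hr)
    · exact ⟨{d}, by simpa using hd, isCompact_singleton, singleton_nonempty d, zero_le⟩
    · obtain ⟨D', hD', cD, hrD⟩ := hD.exists_lt_isCompact hr
      exact ⟨insert d D', insert_subset hd hD', cD.insert d, insert_nonempty _ _,
        hrD.le.trans (measure_mono (subset_insert _ _))⟩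
  have key : ∀ r s, r = 0 ∨ r < volume A → s = 0 ∨ s < volume B → r + s ≤ volume C := by
    intro r s hr hs
    obtain ⟨A', hA', cA, nA, hrA⟩ := approx A hA a ha r hr
    obtain ⟨B', hB', cB, nB, hsB⟩ := approx B hB b hb s hs
    exact (add_le_add hrA hsB).trans (compact_case A' hA' B' hB' cA cB nA nB)
  by_cases hA0 : volume A = 0
  · rw [hA0, zero_add]
    refine le_of_forall_lt_imp_le_of_dense fun s hs => ?_
    simpa using key 0 s (Or.inl rfl) (Or.inr hs)
  by_cases hB0 : volume B = 0
  · rw [hB0, add_zero]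
    refine le_of_forall_lt_imp_le_of_dense fun r hr => ?_
    simpa using key r 0 (Or.inr hr) (Or.inl rfl)
  refine le_of_forall_lt_imp_le_of_dense fun c hc => ?_
  obtain ⟨r, hr, s, hs, hrs⟩ := ENNReal.exists_lt_add_of_lt_add hc hA0 hB0
  exact hrs.le.trans (key r s (Or.inr hr) (Or.inr hs))

/-- Brunn–Minkowski for the dilates by `a` and `b` of two superlevel sets. It needs both sets
non-empty; `hfg` makes them empty together, and equalising suprema is how it is arranged later. -/
theorem volume_superlevel_le {α : Type*} [LinearOrder α] {f g h : ℝ → α} {a b : ℝ} (ha : 0 < a)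
    (hb : 0 < b) (s : α) (hf : MeasurableSet {x | s < f x}) (hg : MeasurableSet {x | s < g x})
    (hfg : (∃ x, s < f x) ↔ ∃ x, s < g x) (hh : ∀ x y, min (f x) (g y) ≤ h (a * x + b * y)) :
    ENNReal.ofReal a * volume {x | s < f x} + ENNReal.ofReal b * volume {x | s < g x}
      ≤ volume {x | s < h x} := by
  by_cases hne : ∃ x, s < f x
  · have hne' := hfg.1 hne
    have key := volume_add_volume_le_of_add_mem (hf.const_smul₀ a) (hg.const_smul₀ b)
      (Set.Nonempty.smul_set (a := a) hne) (Set.Nonempty.smul_set (a := b) hne')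
      (C := {x | s < h x}) (by
        rintro _ ⟨x, hx, rfl⟩ _ ⟨y, hy, rfl⟩
        exact (lt_min hx hy).trans_le (hh x y))
    simpa [Measure.addHaar_smul, abs_of_pos ha, abs_of_pos hb] using key
  · have hne' : ¬ ∃ x, s < g x := fun h => hne (hfg.2 h)
    push Not at hne hne'
    have h1 : {x | s < f x} = ∅ := by ext x; simpa using hne x
    have h2 : {x | s < g x} = ∅ := by ext x; simpa using hne' x
    simp [h1, h2]

theorem lintegral_eq_lintegral_measure_ofReal_lt {α : Type*} [MeasurableSpace α] (μ : Measure α)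
    [SFinite μ] {f : α → ℝ≥0∞} (hf : Measurable f) :
    ∫⁻ x, f x ∂μ = ∫⁻ s in Ioi (0 : ℝ), μ {x | ENNReal.ofReal s < f x} := by
  have h1 : ∀ x, f x = ∫⁻ s in Ioi (0 : ℝ), {x | ENNReal.ofReal s < f x}.indicator 1 x := by
    intro x
    have : ∀ s : ℝ, {x | ENNReal.ofReal s < f x}.indicator (1 : α → ℝ≥0∞) x
        = {s : ℝ | ENNReal.ofReal s < f x}.indicator 1 s := fun s => rfl
    simp_rw [this]
    rw [lintegral_indicator_one (measurableSet_lt (by fun_prop) (by fun_prop)),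
      Measure.restrict_apply (measurableSet_lt (by fun_prop) (by fun_prop))]
    by_cases hx : f x = ∞
    · have : {s : ℝ | ENNReal.ofReal s < f x} = univ := by ext s; simp [hx]
      rw [this, univ_inter, Real.volume_Ioi, hx]
    · have : {s : ℝ | ENNReal.ofReal s < f x} ∩ Ioi 0 = Ioo 0 (f x).toReal := by
        ext s
        simp only [mem_inter_iff, mem_ofPred_eq, mem_Ioi, mem_Ioo]
        constructor
        · rintro ⟨h, h0⟩
          exact ⟨h0, (ENNReal.ofReal_lt_iff_lt_toReal h0.le hx).1 h⟩
        · rintro ⟨h0, h⟩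
          exact ⟨(ENNReal.ofReal_lt_iff_lt_toReal h0.le hx).2 h, h0⟩
      rw [this, Real.volume_Ioo, sub_zero, ENNReal.ofReal_toReal hx]
  have hm : MeasurableSet {z : α × ℝ | ENNReal.ofReal z.2 < f z.1} :=
    measurableSet_lt (by fun_prop) (by fun_prop)
  calc ∫⁻ x, f x ∂μ
      = ∫⁻ x, (∫⁻ s in Ioi (0 : ℝ),
          {x : α | ENNReal.ofReal s < f x}.indicator (1 : α → ℝ≥0∞) x) ∂μ :=
        lintegral_congr h1
    _ = ∫⁻ s in Ioi (0 : ℝ), ∫⁻ x, {x : α | ENNReal.ofReal s < f x}.indicator (1 : α → ℝ≥0∞) x ∂μ := by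
        refine lintegral_lintegral_swap (Measurable.aemeasurable ?_)
        exact (measurable_const (a := (1 : ℝ≥0∞))).indicator hm
    _ = _ := by
        refine lintegral_congr fun s => ?_
        exact lintegral_indicator_one (measurableSet_lt (by fun_prop) (by fun_prop))

/-! ### The Prékopa–Leindler inequality in every dimension -/

theorem ENNReal.rpow_mul_rpow_le_add {a b : ℝ} (ha : 0 < a) (hb : 0 < b) (hab : a + b = 1)
    (x y : ℝ≥0∞) : x ^ a * y ^ b ≤ ENNReal.ofReal a * x + ENNReal.ofReal b * y := by
  rcases eq_or_ne x ∞ with rfl | hx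
  · simp [ENNReal.mul_top, ha]
  rcases eq_or_ne y ∞ with rfl | hy
  · simp [ENNReal.mul_top, hb]
  lift x to NNReal using hx
  lift y to NNReal using hy
  have := NNReal.geom_mean_le_arith_mean2_weighted a.toNNReal b.toNNReal x y
    (by rw [← Real.toNNReal_add ha.le hb.le, hab, Real.toNNReal_one])
  rw [Real.coe_toNNReal a ha.le, Real.coe_toNNReal b hb.le] at this
  rw [← ENNReal.coe_rpow_of_nonneg _ ha.le, ← ENNReal.coe_rpow_of_nonneg _ hb.le,
    ENNReal.ofReal, ENNReal.ofReal]
  exact_mod_cast this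

theorem ENNReal.min_le_rpow_mul_rpow {a b : ℝ} (ha : 0 < a) (hb : 0 < b) (hab : a + b = 1)
    (x y : ℝ≥0∞) : min x y ≤ x ^ a * y ^ b := by
  calc min x y = min x y ^ a * min x y ^ b := by
        rw [← ENNReal.rpow_add_of_nonneg _ _ ha.le hb.le, hab, ENNReal.rpow_one]
    _ ≤ x ^ a * y ^ b := by
        gcongr
        · exact min_le_left _ _
        · exact min_le_right _ _

/-- The Prékopa–Leindler inequality for the volume of `E`. -/
def PrekopaLeindler (E : Type*) [AddCommGroup E] [Module ℝ E] [MeasureSpace E] : Prop :=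
  ∀ a b : ℝ, 0 < a → 0 < b → a + b = 1 → ∀ f g h : E → ℝ≥0∞, Measurable f → Measurable g →
    Measurable h → (∀ x y, f x ^ a * g y ^ b ≤ h (a • x + b • y)) →
    (∫⁻ x, f x) ^ a * (∫⁻ x, g x) ^ b ≤ ∫⁻ x, h x

/-- After division by the suprema, `f` and `g` both have supremum 1, and a minimum is at most a
geometric mean, so superlevel sets can be compared at every level. Integrating over levels gives an
arithmetic-mean bound, stronger than the geometric one by AM-GM. -/
theorem prekopaLeindler_real_of_bounded {a b : ℝ} (ha : 0 < a) (hb : 0 < b) (hab : a + b = 1)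
    {f g h : ℝ → ℝ≥0∞} (hf : Measurable f) (hg : Measurable g) (hh : Measurable h)
    (hfb : ⨆ x, f x ≠ ∞) (hgb : ⨆ x, g x ≠ ∞)
    (H : ∀ x y, f x ^ a * g y ^ b ≤ h (a • x + b • y)) :
    (∫⁻ x, f x) ^ a * (∫⁻ x, g x) ^ b ≤ ∫⁻ x, h x := by
  set M := ⨆ x, f x with hM
  set N := ⨆ x, g x with hN
  by_cases hM0 : M = 0
  · have : ∀ x, f x = 0 := by simpa [hM] using hM0
    simp [this, ha]
  by_cases hN0 : N = 0
  · have : ∀ x, g x = 0 := by simpa [hN] using hN0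
    simp [this, hb]
  have hMa0 : M ^ a ≠ 0 := by simp [hM0, hfb]
  have hNb0 : N ^ b ≠ 0 := by simp [hN0, hgb]
  have hMat : M ^ a ≠ ∞ := ENNReal.rpow_ne_top_of_nonneg ha.le hfb
  have hNbt : N ^ b ≠ ∞ := ENNReal.rpow_ne_top_of_nonneg hb.le hgb
  have hsup : ∀ (u : ℝ → ℝ≥0∞) (S : ℝ≥0∞), S = ⨆ x, u x → S ≠ 0 → S ≠ ∞ → ∀ s : ℝ≥0∞,
      (∃ x, s < S⁻¹ * u x) ↔ s < 1 := by
    intro u S hS hS0 hSt s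
    rw [← lt_iSup_iff, ← ENNReal.mul_iSup, ← hS, ENNReal.inv_mul_cancel hS0 hSt]
  have level : ∀ s : ℝ, ENNReal.ofReal a * volume {x | ENNReal.ofReal s < M⁻¹ * f x}
      + ENNReal.ofReal b * volume {x | ENNReal.ofReal s < N⁻¹ * g x}
      ≤ volume {x | ENNReal.ofReal s < (M ^ a * N ^ b)⁻¹ * h x} := by
    intro s
    refine volume_superlevel_le ha hb _ (measurableSet_lt (by fun_prop) (by fun_prop))
      (measurableSet_lt (by fun_prop) (by fun_prop)) ?_ fun x y => ?_
    · rw [hsup f M hM hM0 hfb, hsup g N hN hN0 hgb]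
    · refine (ENNReal.min_le_rpow_mul_rpow ha hb hab _ _).trans ?_
      rw [ENNReal.mul_rpow_of_nonneg _ _ ha.le, ENNReal.mul_rpow_of_nonneg _ _ hb.le,
        mul_mul_mul_comm, ENNReal.inv_rpow, ENNReal.inv_rpow,
        ← ENNReal.mul_inv (Or.inl hMa0) (Or.inl hMat)]
      gcongr
      exact H x y
  have main : ENNReal.ofReal a * (M⁻¹ * ∫⁻ x, f x) + ENNReal.ofReal b * (N⁻¹ * ∫⁻ x, g x)
      ≤ (M ^ a * N ^ b)⁻¹ * ∫⁻ x, h x := by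
    rw [← lintegral_const_mul _ hf, ← lintegral_const_mul _ hg, ← lintegral_const_mul _ hh,
      lintegral_eq_lintegral_measure_ofReal_lt _ (hf.const_mul _),
      lintegral_eq_lintegral_measure_ofReal_lt _ (hg.const_mul _),
      lintegral_eq_lintegral_measure_ofReal_lt _ (hh.const_mul _),
      ← lintegral_const_mul' _ _ ENNReal.ofReal_ne_top,
      ← lintegral_const_mul' _ _ ENNReal.ofReal_ne_top]
    exact (le_lintegral_add _ _).trans (lintegral_mono level)
  have := (ENNReal.rpow_mul_rpow_le_add ha hb hab _ _).trans main
  rw [ENNReal.mul_rpow_of_nonneg _ _ ha.le, ENNReal.mul_rpow_of_nonneg _ _ hb.le,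
    mul_mul_mul_comm, ENNReal.inv_rpow, ENNReal.inv_rpow,
    ← ENNReal.mul_inv (Or.inl hMa0) (Or.inl hMat)] at this
  rwa [ENNReal.mul_le_mul_iff_right (ENNReal.inv_ne_zero.2 (ENNReal.mul_ne_top hMat hNbt))
    (ENNReal.inv_ne_top.2 (mul_ne_zero hMa0 hNb0))] at this

theorem prekopaLeindler_real : PrekopaLeindler ℝ := by
  intro a b ha hb hab f g h hf hg hh H
  by_cases hf0 : ∫⁻ x, f x = 0
  · simp [hf0, ha]
  by_cases hg0 : ∫⁻ x, g x = 0
  · simp [hg0, hb]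
  have hlim : ∀ u : ℝ → ℝ≥0∞, Measurable u →
      Filter.Tendsto (fun k : ℕ => ∫⁻ x, min (u x) k) Filter.atTop (nhds (∫⁻ x, u x)) := by
    intro u hu
    refine lintegral_tendsto_of_tendsto_of_monotone (fun k => by fun_prop)
      (Filter.Eventually.of_forall fun x i j hij => ?_) (Filter.Eventually.of_forall fun x => ?_)
    · dsimp only
      gcongr
    · simpa using (tendsto_const_nhds (x := u x)).min ENNReal.tendsto_nat_nhds_top
  have hfin : ∀ (u : ℝ → ℝ≥0∞) (k : ℕ), ⨆ x, min (u x) k ≠ ∞ := fun u k =>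
    ((iSup_le fun x => min_le_right _ _).trans_lt (ENNReal.natCast_lt_top k)).ne
  -- Truncation at height `k` reduces to bounded functions. Both integrals are non-zero here, which
  -- excludes `0 · ∞` in the limit of the product.
  refine le_of_tendsto' (ENNReal.Tendsto.mul ((hlim f hf).ennrpow_const a)
    (Or.inl (by simp [hf0, ha, ha.not_gt]))
    ((hlim g hg).ennrpow_const b) (Or.inl (by simp [hg0, hb, hb.not_gt]))) fun k => ?_
  refine prekopaLeindler_real_of_bounded ha hb hab (by fun_prop) (by fun_prop) hh
    (hfin f k) (hfin g k) fun x y => le_trans ?_ (H x y)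
  gcongr <;> exact min_le_left _ _

/-- Tensorisation: the inequality on `F`, applied to slices, says that the partial integrals satisfy
the hypothesis on `E`. -/
theorem PrekopaLeindler.prod {E F : Type*} [AddCommGroup E] [Module ℝ E] [MeasureSpace E]
    [AddCommGroup F] [Module ℝ F] [MeasureSpace F] [SFinite (volume : Measure E)]
    [SFinite (volume : Measure F)] [MeasurableAdd₂ F] [MeasurableConstSMul ℝ F] 
    (hE : PrekopaLeindler E) (hF : PrekopaLeindler F) :
    PrekopaLeindler (E × F) := by
  intro a b ha hb hab f g h hf hg hh H
  rw [Measure.volume_eq_prod, lintegral_prod _ hf.aemeasurable, lintegral_prod _ hg.aemeasurable,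
    lintegral_prod _ hh.aemeasurable]
  refine hE a b ha hb hab _ _ _ hf.lintegral_prod_right' hg.lintegral_prod_right'
    hh.lintegral_prod_right' fun x y => ?_
  exact hF a b ha hb hab _ _ _ (hf.comp measurable_prodMk_left) (hg.comp measurable_prodMk_left)
    (hh.comp measurable_prodMk_left) fun z w => H (x, z) (y, w)

theorem PrekopaLeindler.of_measurePreserving {E F : Type*} [AddCommGroup E] [Module ℝ E]
    [MeasureSpace E] [AddCommGroup F] [Module ℝ F] [MeasureSpace F] (hE : PrekopaLeindler E)
    (φ : E → F) (hφ : MeasurePreserving φ)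
    (hlin : ∀ (a b : ℝ) (x y : E), φ (a • x + b • y) = a • φ x + b • φ y) :
    PrekopaLeindler F := by
  intro a b ha hb hab f g h hf hg hh H
  rw [← hφ.lintegral_comp hf, ← hφ.lintegral_comp hg, ← hφ.lintegral_comp hh]
  refine hE a b ha hb hab _ _ _ (hf.comp hφ.measurable) (hg.comp hφ.measurable)
    (hh.comp hφ.measurable) fun x y => ?_
  rw [hlin]
  exact H _ _

theorem prekopaLeindler_pi (n : ℕ) : PrekopaLeindler (Fin n → ℝ) := by
  induction n with
  | zero =>
    intro a b ha hb hab f g h hf hg hh H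
    rw [MeasureTheory.Measure.volume_pi_eq_dirac 0, lintegral_dirac, lintegral_dirac, lintegral_dirac]
    convert H 0 0
  | succ n ih =>
    refine (prekopaLeindler_real.prod ih).of_measurePreserving _
      (volume_preserving_piFinSuccAbove (fun _ : Fin (n + 1) => ℝ) 0).symm fun a b x y => ?_
    ext i
    refine Fin.cases ?_ (fun j => ?_) i <;>
      simp [MeasurableEquiv.piFinSuccAbove, Fin.insertNthEquiv]

theorem prekopaLeindler_euclideanSpace (n : ℕ) : PrekopaLeindler (EuclideanSpace ℝ (Fin n)) :=
  (prekopaLeindler_pi n).of_measurePreserving _ (PiLp.volume_preserving_toLp (Fin n))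
    fun _ _ _ _ => rfl

/-! ### Weighted distribution functions on the half-line -/

/-- The function `F` multiplied by the density `u ^ (q - 1)` on the positive half-line. -/
noncomputable def rpowWeighted (q : ℝ) (F : ℝ → ℝ) (u : ℝ) : ℝ :=
  if 0 < u then u ^ (q - 1) * F u else 0

theorem measurable_rpowWeighted (q : ℝ) {F : ℝ → ℝ} (hF : Measurable F) :
    Measurable (rpowWeighted q F) := by
  unfold rpowWeighted
  exact Measurable.ite measurableSet_Ioi (by fun_prop) measurable_const

theorem rpowWeighted_nonneg (q : ℝ) {F : ℝ → ℝ} (hF : ∀ u, 0 ≤ F u) (u : ℝ) :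
    0 ≤ rpowWeighted q F u := by
  unfold rpowWeighted
  split_ifs with h
  · exact mul_nonneg (Real.rpow_nonneg h.le _) (hF u)
  · exact le_rfl

theorem rpowWeighted_mono (q : ℝ) {F G : ℝ → ℝ} (hFG : ∀ u, F u ≤ G u) (u : ℝ) :
    rpowWeighted q F u ≤ rpowWeighted q G u := by
  unfold rpowWeighted
  split_ifs with h
  · exact mul_le_mul_of_nonneg_left (hFG u) (Real.rpow_nonneg h.le _)
  · exact le_rfl

theorem rpowWeighted_comp_mul {q a : ℝ} (ha : 0 < a) (F : ℝ → ℝ) (u : ℝ) :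
    rpowWeighted q (fun w => F (a * w)) u = a ^ (1 - q) * rpowWeighted q F (a * u) := by
  unfold rpowWeighted
  by_cases hu : 0 < u
  · rw [if_pos hu, if_pos (mul_pos ha hu), Real.mul_rpow ha.le hu.le, ← mul_assoc, ← mul_assoc,
      ← Real.rpow_add ha]
    simp
  · rw [if_neg hu, if_neg (by simpa [mul_pos_iff_of_pos_left ha] using hu), mul_zero]

/-- The minimum is at most the geometric mean with the point-dependent weights `α = u/(u+v)`, `β =
v/(u+v)`, which are those of `H`. The density factors recombine correctly because `q - 1 < 0`. -/
theorem min_rpowWeighted_le {q a b : ℝ} (hq : q < 1) (ha : 0 < a) (hb : 0 < b) (hab : a + b = 1)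
    {F₁ F₂ F₃ : ℝ → ℝ} (h₁ : ∀ u, 0 ≤ F₁ u) (h₂ : ∀ u, 0 ≤ F₂ u) (h₃ : ∀ u, 0 ≤ F₃ u)
    (H : ∀ u v, 0 < u → 0 < v → F₁ u ^ (u / (u + v)) * F₂ v ^ (v / (u + v)) ≤ F₃ (u + v))
    (x y : ℝ) :
    min (rpowWeighted q (fun w => F₁ (a * w)) x) (rpowWeighted q (fun w => F₂ (b * w)) y)
      ≤ rpowWeighted q F₃ (a * x + b * y) := by
  by_cases hx : 0 < x
  swap
  · refine (min_le_left _ _).trans ?_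
    simpa [rpowWeighted, hx] using rpowWeighted_nonneg q h₃ (a * x + b * y)
  by_cases hy : 0 < y
  swap
  · refine (min_le_right _ _).trans ?_
    simpa [rpowWeighted, hy] using rpowWeighted_nonneg q h₃ (a * x + b * y)
  have hu : 0 < a * x := mul_pos ha hx
  have hv : 0 < b * y := mul_pos hb hy
  set u := a * x
  set v := b * y
  have hw : 0 < u + v := add_pos hu hv
  set α := u / (u + v)
  set β := v / (u + v)
  have hα : 0 < α := div_pos hu hw
  have hβ : 0 < β := div_pos hv hw
  have hαβ : α + β = 1 := by simp only [α, β]; field_simp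
  simp only [rpowWeighted, hx, hy, hw, if_true]
  have hA : 0 ≤ x ^ (q - 1) * F₁ (a * x) := mul_nonneg (Real.rpow_nonneg hx.le _) (h₁ _)
  have hB : 0 ≤ y ^ (q - 1) * F₂ (b * y) := mul_nonneg (Real.rpow_nonneg hy.le _) (h₂ _)
  set A := x ^ (q - 1) * F₁ (a * x)
  set B := y ^ (q - 1) * F₂ (b * y)
  have hm : 0 ≤ min A B := le_min hA hB
  -- `u + v` is exactly the harmonic mean of `x` and `y` with weights `α`, `β`, as `α/x + β/y = (a +
  -- b)/(u + v)`.
  have hamgm : u + v ≤ x ^ α * y ^ β := by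
    have h := Real.geom_mean_le_arith_mean2_weighted hα.le hβ.le (inv_nonneg.2 hx.le)
      (inv_nonneg.2 hy.le) hαβ
    rw [Real.inv_rpow hx.le, Real.inv_rpow hy.le, ← mul_inv] at h
    have h' : α * x⁻¹ + β * y⁻¹ = (u + v)⁻¹ := by
      have e1 : α * x⁻¹ = a * (u + v)⁻¹ := by
        simp only [α, div_eq_mul_inv]
        rw [show u = a * x from rfl]
        field_simp
      have e2 : β * y⁻¹ = b * (u + v)⁻¹ := by
        simp only [β, div_eq_mul_inv]
        rw [show v = b * y from rfl]
        field_simp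
      rw [e1, e2, ← add_mul, hab, one_mul]
    rw [h'] at h
    exact (inv_le_inv₀ (by positivity) hw).1 h
  calc min A B = min A B ^ α * min A B ^ β := by
        rw [← Real.rpow_add_of_nonneg hm hα.le hβ.le, hαβ, Real.rpow_one]
    _ ≤ A ^ α * B ^ β := by
        gcongr
        · exact min_le_left _ _
        · exact min_le_right _ _
    _ = (x ^ α * y ^ β) ^ (q - 1) * (F₁ u ^ α * F₂ v ^ β) := by
        rw [Real.mul_rpow (Real.rpow_nonneg hx.le _) (h₁ _),
          Real.mul_rpow (Real.rpow_nonneg hy.le _) (h₂ _),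
          Real.mul_rpow (Real.rpow_nonneg hx.le _) (Real.rpow_nonneg hy.le _),
          ← Real.rpow_mul hx.le, ← Real.rpow_mul hy.le, ← Real.rpow_mul hx.le,
          ← Real.rpow_mul hy.le, mul_comm α, mul_comm β]
        ring
    _ ≤ (u + v) ^ (q - 1) * F₃ (u + v) := by
        refine mul_le_mul (Real.rpow_le_rpow_of_nonpos hw hamgm (by linarith)) (H u v hu hv)
          (mul_nonneg (Real.rpow_nonneg (h₁ _) _) (Real.rpow_nonneg (h₂ _) _))
          (Real.rpow_nonneg hw.le _)

/-- Rescaling the argument by `a` multiplies the supremum by `a^(1-q)`, so `a` and `b` can be chosen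
to equalise the two suprema. Vanishing below `ε` keeps the suprema finite, since the density blows
up at 0. -/
theorem exists_weights_superlevel {q ε : ℝ} (hq : q < 1) (hε : 0 < ε) {F₁ F₂ F₃ : ℝ → ℝ}
    (hm₁ : Measurable F₁) (hm₂ : Measurable F₂)
    (h₁ : ∀ u, 0 ≤ F₁ u) (h₂ : ∀ u, 0 ≤ F₂ u) (h₃ : ∀ u, 0 ≤ F₃ u)
    (h₁' : ∀ u, F₁ u ≤ 1) (h₂' : ∀ u, F₂ u ≤ 1) (h₁ε : ∀ u < ε, F₁ u = 0)
    (h₂ε : ∀ u < ε, F₂ u = 0) (h₁p : ∃ u, 0 < F₁ u) (h₂p : ∃ u, 0 < F₂ u)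
    (H : ∀ u v, 0 < u → 0 < v → F₁ u ^ (u / (u + v)) * F₂ v ^ (v / (u + v)) ≤ F₃ (u + v)) :
    ∃ a b : ℝ, 0 < a ∧ 0 < b ∧ a + b = 1 ∧ ∀ s : ℝ,
      ENNReal.ofReal a * volume {w | s < rpowWeighted q (fun w => F₁ (a * w)) w}
        + ENNReal.ofReal b * volume {w | s < rpowWeighted q (fun w => F₂ (b * w)) w}
        ≤ volume {w | s < rpowWeighted q F₃ w} := by
  have bdd : ∀ F : ℝ → ℝ, (∀ u, 0 ≤ F u) → (∀ u, F u ≤ 1) → (∀ u < ε, F u = 0) →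
      BddAbove (range (rpowWeighted q F)) := by
    rintro F hF0 hF1 hFε
    refine ⟨ε ^ (q - 1), ?_⟩
    rintro _ ⟨u, rfl⟩
    unfold rpowWeighted
    split_ifs with hu
    · rcases lt_or_ge u ε with h | h
      · rw [hFε u h, mul_zero]
        positivity
      · calc u ^ (q - 1) * F u ≤ u ^ (q - 1) * 1 := by gcongr; exact hF1 u
          _ ≤ ε ^ (q - 1) := by
            rw [mul_one]
            exact Real.rpow_le_rpow_of_nonpos hε h (by linarith)
    · positivity
  have pos : ∀ F : ℝ → ℝ, BddAbove (range (rpowWeighted q F)) → (∀ u < ε, F u = 0) →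
      (∃ u, 0 < F u) → 0 < ⨆ u, rpowWeighted q F u := by
    rintro F hb hFε ⟨u, hu⟩
    have hu0 : 0 < u := hε.trans_le (not_lt.1 fun h => hu.ne' (hFε u h))
    refine (lt_ciSup_iff hb).2 ⟨u, ?_⟩
    rw [rpowWeighted, if_pos hu0]
    positivity
  have b₁ := bdd F₁ h₁ h₁' h₁ε
  have b₂ := bdd F₂ h₂ h₂' h₂ε
  have p₁ := pos F₁ b₁ h₁ε h₁p
  have p₂ := pos F₂ b₂ h₂ε h₂p
  set M₁ := ⨆ u, rpowWeighted q F₁ u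
  set M₂ := ⨆ u, rpowWeighted q F₂ u
  have hq' : 0 < 1 - q := by linarith
  -- Solving `a^(1-q) M₁ = b^(1-q) M₂` with `a + b = 1` gives `a` and `b` proportional to `m₁` and
  -- `m₂`.
  set m₁ := M₁ ^ (-(1 - q)⁻¹)
  set m₂ := M₂ ^ (-(1 - q)⁻¹)
  have hm₁0 : 0 < m₁ := by positivity
  have hm₂0 : 0 < m₂ := by positivity
  have exists_iff : ∀ (F : ℝ → ℝ) (a s : ℝ), 0 < a → BddAbove (range (rpowWeighted q F)) →
      ((∃ x, s < rpowWeighted q (fun w => F (a * w)) x)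
        ↔ s < a ^ (1 - q) * ⨆ u, rpowWeighted q F u) := by
    intro F a s ha hb
    rw [← div_lt_iff₀' (by positivity), lt_ciSup_iff hb]
    simp_rw [rpowWeighted_comp_mul ha, div_lt_iff₀' (Real.rpow_pos_of_pos ha _)]
    constructor
    · rintro ⟨x, hx⟩
      exact ⟨a * x, hx⟩
    · rintro ⟨x, hx⟩
      refine ⟨x / a, ?_⟩
      rwa [mul_div_cancel₀ _ ha.ne']
  have scale : ∀ M m : ℝ, 0 < M → m = M ^ (-(1 - q)⁻¹) →
      (m / (m₁ + m₂)) ^ (1 - q) * M = ((m₁ + m₂) ^ (1 - q))⁻¹ := by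
    rintro M m hM rfl
    rw [Real.div_rpow (by positivity) (by positivity), ← Real.rpow_mul hM.le, neg_mul,
      inv_mul_cancel₀ hq'.ne', Real.rpow_neg_one]
    field_simp
  have ha : 0 < m₁ / (m₁ + m₂) := by positivity
  have hb : 0 < m₂ / (m₁ + m₂) := by positivity
  have hab : m₁ / (m₁ + m₂) + m₂ / (m₁ + m₂) = 1 := by field_simp
  refine ⟨m₁ / (m₁ + m₂), m₂ / (m₁ + m₂), ha, hb, hab, fun s => ?_⟩
  refine volume_superlevel_le ha hb s
    (measurableSet_lt measurable_const (measurable_rpowWeighted q (by fun_prop)))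
    (measurableSet_lt measurable_const (measurable_rpowWeighted q (by fun_prop))) ?_
    (min_rpowWeighted_le hq ha hb hab h₁ h₂ h₃ H)
  rw [exists_iff F₁ _ s ha b₁, exists_iff F₂ _ s hb b₂, scale M₁ m₁ p₁ rfl, scale M₂ m₂ p₂ rfl]

theorem lintegral_ofReal_eq_lintegral_measure_lt {f : ℝ → ℝ} (hf : Measurable f) :
    ∫⁻ x, ENNReal.ofReal (f x) = ∫⁻ s in Ioi (0 : ℝ), volume {x | s < f x} := by
  rw [lintegral_eq_lintegral_measure_ofReal_lt _ (by fun_prop)]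
  refine setLIntegral_congr_fun measurableSet_Ioi fun s hs => ?_
  simp only [ENNReal.ofReal_lt_ofReal_iff_of_nonneg (le_of_lt (mem_Ioi.1 hs))]

/-- Tonelli on the region `f ≤ s < b`. The subtraction is done level by level because the intended
`b`, namely `u^(q-1)`, has infinite integral but superlevel sets of finite length. -/
theorem lintegral_ofReal_sub_eq {f b : ℝ → ℝ} (hf : Measurable f) (hb : Measurable b)
    (hf0 : ∀ x, 0 ≤ f x) (hfb : ∀ x, f x ≤ b x)
    (hfin : ∀ s, 0 < s → volume {x | s < b x} ≠ ∞) :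
    ∫⁻ x, ENNReal.ofReal (b x - f x)
      = ∫⁻ s in Ioi (0 : ℝ), (volume {x | s < b x} - volume {x | s < f x}) := by
  have hS₁ : MeasurableSet {z : ℝ × ℝ | f z.1 ≤ z.2} :=
    measurableSet_le (by fun_prop) (by fun_prop)
  have hS₂ : MeasurableSet {z : ℝ × ℝ | z.2 < b z.1} :=
    measurableSet_lt (by fun_prop) (by fun_prop)
  have hS : MeasurableSet {z : ℝ × ℝ | f z.1 ≤ z.2 ∧ z.2 < b z.1} := hS₁.inter hS₂
  calc ∫⁻ x, ENNReal.ofReal (b x - f x)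
      = ∫⁻ x, (∫⁻ s in Ioi (0 : ℝ),
          {z : ℝ × ℝ | f z.1 ≤ z.2 ∧ z.2 < b z.1}.indicator (1 : ℝ × ℝ → ℝ≥0∞) (x, s)) := by
        refine lintegral_congr fun x => ?_
        have : ∀ s, {z : ℝ × ℝ | f z.1 ≤ z.2 ∧ z.2 < b z.1}.indicator (1 : ℝ × ℝ → ℝ≥0∞) (x, s)
            = (Ico (f x) (b x)).indicator 1 s := fun s => rfl
        simp_rw [this]
        rw [lintegral_indicator_one measurableSet_Ico, Measure.restrict_apply measurableSet_Ico,
          ← Real.volume_Ico]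
        refine le_antisymm ?_ (measure_mono inter_subset_left)
        -- The interval `[f x, b x)` may contain the level 0, which is outside the positive
        -- half-line.
        rw [← measure_sdiff_null (measure_singleton (μ := volume) (0 : ℝ))]
        refine measure_mono fun s hs => ⟨hs.1, ?_⟩
        exact lt_of_le_of_ne ((hf0 x).trans hs.1.1) fun h => hs.2 h.symm
    _ = ∫⁻ s in Ioi (0 : ℝ), (∫⁻ x,
          {z : ℝ × ℝ | f z.1 ≤ z.2 ∧ z.2 < b z.1}.indicator (1 : ℝ × ℝ → ℝ≥0∞) (x, s)) :=
        lintegral_lintegral_swap (((measurable_const (a := (1 : ℝ≥0∞))).indicator hS).aemeasurable)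
    _ = _ := by
        refine setLIntegral_congr_fun measurableSet_Ioi fun s hs => ?_
        have : ∀ x, {z : ℝ × ℝ | f z.1 ≤ z.2 ∧ z.2 < b z.1}.indicator (1 : ℝ × ℝ → ℝ≥0∞) (x, s)
            = ({x | s < b x} \ {x | s < f x}).indicator 1 x := by
          intro x
          have : (x, s) ∈ {z : ℝ × ℝ | f z.1 ≤ z.2 ∧ z.2 < b z.1}
              ↔ x ∈ {x | s < b x} \ {x | s < f x} := by
            simp [and_comm]
          by_cases h : x ∈ {x | s < b x} \ {x | s < f x}
          · rw [indicator_of_mem h, indicator_of_mem (this.2 h)]; rfl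
          · rw [indicator_of_notMem h, indicator_of_notMem (fun h' => h (this.1 h'))]
        have hsub : {x | s < f x} ⊆ {x | s < b x} := fun x hx => lt_of_lt_of_le hx (hfb x)
        have hmf : MeasurableSet {x | s < f x} := measurableSet_lt (by fun_prop) (by fun_prop)
        have hmb : MeasurableSet {x | s < b x} := measurableSet_lt (by fun_prop) (by fun_prop)
        simp_rw [this]
        rw [lintegral_indicator_one (hmb.diff hmf), measure_sdiff hsub hmf.nullMeasurableSet
          (ne_top_of_le_ne_top (hfin s hs) (measure_mono hsub))]

theorem volume_lt_rpowWeighted_one_ne_top {q s : ℝ} (hq : q < 1) (hs : 0 < s) :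
    volume {w | s < rpowWeighted q (fun _ => 1) w} ≠ ∞ := by
  refine ne_top_of_le_ne_top (b := volume (Icc 0 (s ^ (q - 1)⁻¹))) (by simp) (measure_mono ?_)
  intro w hw
  simp only [rpowWeighted, mul_one, mem_ofPred_eq] at hw
  split_ifs at hw with h
  · exact ⟨h.le, (Real.le_rpow_inv_iff_of_neg h hs (by linarith)).2 hw.le⟩
  · exact absurd hw hs.not_gt

theorem lintegral_rpowWeighted_le {q a b : ℝ} {F₁ F₂ F₃ : ℝ → ℝ}
    (hm₁ : Measurable F₁) (hm₂ : Measurable F₂) (hm₃ : Measurable F₃)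
    (H : ∀ s : ℝ, ENNReal.ofReal a * volume {w | s < rpowWeighted q F₁ w}
        + ENNReal.ofReal b * volume {w | s < rpowWeighted q F₂ w}
        ≤ volume {w | s < rpowWeighted q F₃ w}) :
    ENNReal.ofReal a * (∫⁻ w, ENNReal.ofReal (rpowWeighted q F₁ w))
        + ENNReal.ofReal b * (∫⁻ w, ENNReal.ofReal (rpowWeighted q F₂ w))
      ≤ ∫⁻ w, ENNReal.ofReal (rpowWeighted q F₃ w) := by
  rw [lintegral_ofReal_eq_lintegral_measure_lt (measurable_rpowWeighted q hm₁),
    lintegral_ofReal_eq_lintegral_measure_lt (measurable_rpowWeighted q hm₂),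
    lintegral_ofReal_eq_lintegral_measure_lt (measurable_rpowWeighted q hm₃),
    ← lintegral_const_mul' _ _ ENNReal.ofReal_ne_top,
    ← lintegral_const_mul' _ _ ENNReal.ofReal_ne_top]
  exact (le_lintegral_add _ _).trans (lintegral_mono H)

theorem rpowWeighted_one_sub (q : ℝ) (F : ℝ → ℝ) (u : ℝ) :
    rpowWeighted q (fun w => 1 - F w) u = rpowWeighted q (fun _ => 1) u - rpowWeighted q F u := by
  unfold rpowWeighted
  split_ifs <;> ring

/-- At each level, subtract the superlevel inequality from the length `B` for the bare density,
written as `a B + b B`; the inequality reverses. -/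
theorem lintegral_rpowWeighted_one_sub_le {q a b : ℝ} (hq : q < 1) (ha : 0 < a) (hb : 0 < b)
    (hab : a + b = 1) {F₁ F₂ F₃ : ℝ → ℝ}
    (hm₁ : Measurable F₁) (hm₂ : Measurable F₂) (hm₃ : Measurable F₃)
    (h₁ : ∀ u, F₁ u ∈ Icc (0 : ℝ) 1) (h₂ : ∀ u, F₂ u ∈ Icc (0 : ℝ) 1)
    (h₃ : ∀ u, F₃ u ∈ Icc (0 : ℝ) 1)
    (H : ∀ s : ℝ, ENNReal.ofReal a * volume {w | s < rpowWeighted q F₁ w}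
        + ENNReal.ofReal b * volume {w | s < rpowWeighted q F₂ w}
        ≤ volume {w | s < rpowWeighted q F₃ w}) :
    ∫⁻ w, ENNReal.ofReal (rpowWeighted q (fun w => 1 - F₃ w) w)
      ≤ ENNReal.ofReal a * (∫⁻ w, ENNReal.ofReal (rpowWeighted q (fun w => 1 - F₁ w) w))
        + ENNReal.ofReal b * (∫⁻ w, ENNReal.ofReal (rpowWeighted q (fun w => 1 - F₂ w) w)) := by
  have sub_eq : ∀ F : ℝ → ℝ, Measurable F → (∀ u, F u ∈ Icc (0 : ℝ) 1) →
      ∫⁻ w, ENNReal.ofReal (rpowWeighted q (fun w => 1 - F w) w) = ∫⁻ s in Ioi (0 : ℝ),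
        (volume {w | s < rpowWeighted q (fun _ => 1) w} - volume {w | s < rpowWeighted q F w}) := by
    intro F hm h
    simp_rw [rpowWeighted_one_sub q F]
    exact lintegral_ofReal_sub_eq (measurable_rpowWeighted q hm)
      (measurable_rpowWeighted q measurable_const) (rpowWeighted_nonneg q fun u => (h u).1)
      (rpowWeighted_mono q fun u => (h u).2) fun s hs => volume_lt_rpowWeighted_one_ne_top hq hs
  have meas : ∀ F : ℝ → ℝ, Measurable fun s => volume {w | s < rpowWeighted q F w} := by
    intro F
    have : Antitone fun s => volume {w | s < rpowWeighted q F w} := by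
      intro s t hst
      exact measure_mono fun w hw => lt_of_le_of_lt hst hw
    exact this.measurable
  have meas₁ : Measurable fun s => ENNReal.ofReal a *
      (volume {w | s < rpowWeighted q (fun _ => 1) w} - volume {w | s < rpowWeighted q F₁ w}) :=
    ((meas _).sub (meas _)).const_mul _
  rw [sub_eq F₁ hm₁ h₁, sub_eq F₂ hm₂ h₂, sub_eq F₃ hm₃ h₃,
    ← lintegral_const_mul' _ _ ENNReal.ofReal_ne_top,
    ← lintegral_const_mul' _ _ ENNReal.ofReal_ne_top,
    ← lintegral_add_left meas₁]
  refine lintegral_mono fun s => ?_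
  set B := volume {w | s < rpowWeighted q (fun _ => 1) w}
  rw [ENNReal.mul_sub fun _ _ => ENNReal.ofReal_ne_top,
    ENNReal.mul_sub fun _ _ => ENNReal.ofReal_ne_top]
  calc B - volume {w | s < rpowWeighted q F₃ w}
      ≤ B - (ENNReal.ofReal a * volume {w | s < rpowWeighted q F₁ w}
        + ENNReal.ofReal b * volume {w | s < rpowWeighted q F₂ w}) := tsub_le_tsub_left (H s) _
    _ = (ENNReal.ofReal a * B + ENNReal.ofReal b * B)
        - (ENNReal.ofReal a * volume {w | s < rpowWeighted q F₁ w}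
        + ENNReal.ofReal b * volume {w | s < rpowWeighted q F₂ w}) := by
        rw [← add_mul, ← ENNReal.ofReal_add ha.le hb.le, hab, ENNReal.ofReal_one, one_mul]
    _ ≤ _ := add_tsub_add_le_tsub_add_tsub

/-! ### Moments through distribution functions -/

section Moments

variable {Ω : Type*} [MeasurableSpace Ω] (P : Measure Ω) [IsProbabilityMeasure P]

theorem lintegral_Ioi_rpow {q c : ℝ} (hq : q < 0) (hc : 0 < c) :
    ENNReal.ofReal (-q) * ∫⁻ u in Ioi c, ENNReal.ofReal (u ^ (q - 1)) = ENNReal.ofReal (c ^ q) := by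
  rw [← ofReal_integral_eq_lintegral_ofReal (integrableOn_Ioi_rpow_of_lt (by linarith) hc)
    ((ae_restrict_iff' measurableSet_Ioi).2 (Filter.Eventually.of_forall fun u hu =>
      Real.rpow_nonneg (hc.trans hu).le _)), integral_Ioi_rpow_of_lt (by linarith) hc,
    ← ENNReal.ofReal_mul (by linarith)]
  congr 1
  rw [sub_add_cancel]
  field_simp [hq.ne]

theorem lintegral_Ioc_rpow {q c : ℝ} (hq : 0 < q) (hc : 0 < c) :
    ENNReal.ofReal q * ∫⁻ u in Ioc 0 c, ENNReal.ofReal (u ^ (q - 1)) = ENNReal.ofReal (c ^ q) := by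
  have hint : IntegrableOn (fun u : ℝ => u ^ (q - 1)) (Ioc 0 c) := by
    rw [← intervalIntegrable_iff_integrableOn_Ioc_of_le hc.le]
    exact intervalIntegral.intervalIntegrable_rpow' (by linarith)
  rw [← ofReal_integral_eq_lintegral_ofReal hint
    ((ae_restrict_iff' measurableSet_Ioc).2 (Filter.Eventually.of_forall fun u hu =>
      Real.rpow_nonneg hu.1.le _)), ← intervalIntegral.integral_of_le hc.le,
    integral_rpow (Or.inl (by linarith)), ← ENNReal.ofReal_mul hq.le]
  congr 1
  rw [sub_add_cancel, Real.zero_rpow hq.ne', sub_zero]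
  field_simp

/-- The Tonelli step common to both moment formulas: `S` is the region `U ≤ u` when `q < 0` and `u <
U` when `q > 0`. -/
theorem lintegral_rpowWeighted_measureReal {q : ℝ} {S : Set (Ω × ℝ)} (hS : MeasurableSet S) :
    ∫⁻ u, ENNReal.ofReal (rpowWeighted q (fun w => P.real {ω | (ω, w) ∈ S}) u)
      = ∫⁻ ω, (∫⁻ u in {u | (ω, u) ∈ S} ∩ Ioi 0, ENNReal.ofReal (u ^ (q - 1))) ∂P := by
  have hm : Measurable fun u : ℝ => ENNReal.ofReal (u ^ (q - 1)) := by fun_prop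
  calc ∫⁻ u, ENNReal.ofReal (rpowWeighted q (fun w => P.real {ω | (ω, w) ∈ S}) u)
      = ∫⁻ u in Ioi (0 : ℝ), (∫⁻ ω, S.indicator (fun z => ENNReal.ofReal (z.2 ^ (q - 1))) (ω, u) ∂P)
        := by
        rw [← lintegral_indicator measurableSet_Ioi]
        refine lintegral_congr fun u => ?_
        by_cases hu : 0 < u
        · rw [indicator_of_mem (mem_Ioi.2 hu), rpowWeighted, if_pos hu]
          have : ∀ ω, S.indicator (fun z => ENNReal.ofReal (z.2 ^ (q - 1))) (ω, u)
              = {ω | (ω, u) ∈ S}.indicator (fun _ => ENNReal.ofReal (u ^ (q - 1))) ω :=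
            fun ω => rfl
          simp_rw [this]
          have hSu : MeasurableSet {ω | (ω, u) ∈ S} := measurable_prodMk_right hS
          rw [lintegral_indicator_const hSu,
            ENNReal.ofReal_mul (Real.rpow_nonneg hu.le _), ofReal_measureReal]
        · rw [indicator_of_notMem (by simpa using hu), rpowWeighted, if_neg hu, ENNReal.ofReal_zero]
    _ = ∫⁻ ω, (∫⁻ u in Ioi (0 : ℝ),
          S.indicator (fun z => ENNReal.ofReal (z.2 ^ (q - 1))) (ω, u)) ∂P :=
        lintegral_lintegral_swap
          (((hm.comp measurable_snd).indicator hS).comp measurable_swap).aemeasurable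
    _ = _ := by
        refine lintegral_congr fun ω => ?_
        have : ∀ u, S.indicator (fun z => ENNReal.ofReal (z.2 ^ (q - 1))) (ω, u)
            = {u | (ω, u) ∈ S}.indicator (fun u => ENNReal.ofReal (u ^ (q - 1))) u := fun u => rfl
        simp_rw [this]
        have hSω : MeasurableSet {u | (ω, u) ∈ S} := measurable_prodMk_left hS
        rw [lintegral_indicator hSω, Measure.restrict_restrict hSω]

theorem lintegral_rpow_of_neg {q : ℝ} (hq : q < 0) {U : Ω → ℝ} (hU : Measurable U)
    (hpos : ∀ ω, 0 < U ω) :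
    ∫⁻ ω, ENNReal.ofReal (U ω ^ q) ∂P = ENNReal.ofReal (-q) *
      ∫⁻ u, ENNReal.ofReal (rpowWeighted q (fun w => P.real {ω | U ω ≤ w}) u) := by
  have hS : MeasurableSet {z : Ω × ℝ | U z.1 ≤ z.2} := measurableSet_le (by fun_prop) (by fun_prop)
  have := lintegral_rpowWeighted_measureReal P (q := q) hS
  simp only [mem_ofPred_eq] at this
  rw [this, ← lintegral_const_mul' _ _ ENNReal.ofReal_ne_top]
  refine lintegral_congr fun ω => ?_
  have h : {u | U ω ≤ u} ∩ Ioi 0 = Ici (U ω) := by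
    ext u
    exact ⟨fun h => h.1, fun h => ⟨h, (hpos ω).trans_le h⟩⟩
  rw [h, setLIntegral_congr Ioi_ae_eq_Ici.symm, lintegral_Ioi_rpow hq (hpos ω)]

theorem lintegral_rpow_of_pos {q : ℝ} (hq : 0 < q) {U : Ω → ℝ} (hU : Measurable U)
    (hpos : ∀ ω, 0 < U ω) :
    ∫⁻ ω, ENNReal.ofReal (U ω ^ q) ∂P = ENNReal.ofReal q *
      ∫⁻ u, ENNReal.ofReal (rpowWeighted q (fun w => 1 - P.real {ω | U ω ≤ w}) u) := by
  have hS : MeasurableSet {z : Ω × ℝ | z.2 < U z.1} := measurableSet_lt (by fun_prop) (by fun_prop)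
  have := lintegral_rpowWeighted_measureReal P (q := q) hS
  have hcompl : ∀ w, 1 - P.real {ω | U ω ≤ w} = P.real {ω | (ω, w) ∈ {z : Ω × ℝ | z.2 < U z.1}} := by
    intro w
    rw [← probReal_compl_eq_one_sub (measurableSet_le hU measurable_const)]
    congr 1
    ext ω
    simp
  simp_rw [hcompl]
  rw [this, ← lintegral_const_mul' _ _ ENNReal.ofReal_ne_top]
  refine lintegral_congr fun ω => ?_
  have h : {u | (ω, u) ∈ {z : Ω × ℝ | z.2 < U z.1}} ∩ Ioi 0 = Ioo 0 (U ω) := by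
    ext u
    exact ⟨fun h => ⟨h.2, h.1⟩, fun h => ⟨h.2, h.1⟩⟩
  rw [h, setLIntegral_congr Ioo_ae_eq_Ioc, lintegral_Ioc_rpow hq (hpos ω)]

/-- The two signs of `q` give opposite inequalities because the moment is governed by `F` for `q <
0` and by `1 - F` for `q > 0`. The weights come from the superlevel comparison. -/
theorem exists_weights_lintegral_rpow {q ε : ℝ} (hq : q < 1) (hε : 0 < ε) {U V W : Ω → ℝ}
    (hU : Measurable U) (hV : Measurable V) (hW : Measurable W) (hUε : ∀ ω, ε ≤ U ω)
    (hVε : ∀ ω, ε ≤ V ω) (hW0 : ∀ ω, 0 < W ω)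
    (H : ∀ u v, 0 < u → 0 < v → P.real {ω | U ω ≤ u} ^ (u / (u + v)) *
      P.real {ω | V ω ≤ v} ^ (v / (u + v)) ≤ P.real {ω | W ω ≤ u + v}) :
    ∃ a b : ℝ, 0 < a ∧ 0 < b ∧ a + b = 1 ∧
      (q < 0 → ENNReal.ofReal a * ∫⁻ ω, ENNReal.ofReal ((U ω / a) ^ q) ∂P
        + ENNReal.ofReal b * ∫⁻ ω, ENNReal.ofReal ((V ω / b) ^ q) ∂P
        ≤ ∫⁻ ω, ENNReal.ofReal (W ω ^ q) ∂P) ∧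
      (0 < q → ∫⁻ ω, ENNReal.ofReal (W ω ^ q) ∂P
        ≤ ENNReal.ofReal a * ∫⁻ ω, ENNReal.ofReal ((U ω / a) ^ q) ∂P
        + ENNReal.ofReal b * ∫⁻ ω, ENNReal.ofReal ((V ω / b) ^ q) ∂P) := by
  have mono : ∀ X : Ω → ℝ, Monotone fun u => P.real {ω | X ω ≤ u} := fun X u v huv =>
    measureReal_mono fun ω hω => le_trans hω huv
  have pos : ∀ X : Ω → ℝ, ∃ u, 0 < P.real {ω | X ω ≤ u} := by
    intro X
    by_contra! h
    have h0 : ∀ k : ℕ, P {ω | X ω ≤ k} = 0 := fun k =>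
      (measureReal_eq_zero_iff).1 (le_antisymm (h k) measureReal_nonneg)
    have : (⋃ k : ℕ, {ω | X ω ≤ k}) = univ := by
      ext ω
      simpa using exists_nat_ge (X ω)
    have hP := measure_iUnion_null h0
    rw [this, measure_univ] at hP
    exact one_ne_zero hP
  have zero : ∀ X : Ω → ℝ, (∀ ω, ε ≤ X ω) → ∀ u < ε, P.real {ω | X ω ≤ u} = 0 := by
    intro X hX u hu
    have : {ω | X ω ≤ u} = ∅ := by
      ext ω
      simpa using hu.trans_le (hX ω)
    rw [this, measureReal_empty]
  have scaled : ∀ (X : Ω → ℝ) (c : ℝ), 0 < c →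
      (fun w => P.real {ω | X ω ≤ c * w}) = fun w => P.real {ω | X ω / c ≤ w} := by
    intro X c hc
    funext w
    simp_rw [div_le_iff₀' hc]
  have mem : ∀ X : Ω → ℝ, ∀ u, P.real {ω | X ω ≤ u} ∈ Icc (0 : ℝ) 1 := fun X u =>
    ⟨measureReal_nonneg, measureReal_le_one⟩
  obtain ⟨a, b, ha, hb, hab, key⟩ := exists_weights_superlevel hq hε (mono U).measurable
    (mono V).measurable (fun u => (mem U u).1) (fun u => (mem V u).1) (fun u => (mem W u).1)
    (fun u => (mem U u).2) (fun u => (mem V u).2) (zero U hUε) (zero V hVε) (pos U) (pos V) H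
  have hU0 : ∀ ω, 0 < U ω / a := fun ω => div_pos (hε.trans_le (hUε ω)) ha
  have hV0 : ∀ ω, 0 < V ω / b := fun ω => div_pos (hε.trans_le (hVε ω)) hb
  simp only [scaled U a ha, scaled V b hb] at key
  refine ⟨a, b, ha, hb, hab, fun hq0 => ?_, fun hq0 => ?_⟩
  · rw [lintegral_rpow_of_neg P hq0 (hU.div_const a) hU0,
      lintegral_rpow_of_neg P hq0 (hV.div_const b) hV0, lintegral_rpow_of_neg P hq0 hW hW0,
      mul_left_comm, mul_left_comm (ENNReal.ofReal b), ← mul_add]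
    gcongr
    exact lintegral_rpowWeighted_le (mono _).measurable (mono _).measurable (mono _).measurable key
  · rw [lintegral_rpow_of_pos P hq0 (hU.div_const a) hU0,
      lintegral_rpow_of_pos P hq0 (hV.div_const b) hV0, lintegral_rpow_of_pos P hq0 hW hW0,
      mul_left_comm, mul_left_comm (ENNReal.ofReal b), ← mul_add]
    gcongr
    exact lintegral_rpowWeighted_one_sub_le hq ha hb hab (mono _).measurable (mono _).measurable
      (mono _).measurable (mem _) (mem _) (mem _) key

theorem rpow_add_le_of_neg {q a b x y : ℝ} (hq : q < 0) (ha : 0 < a) (hb : 0 < b) (hab : a + b = 1)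
    (hx : 0 < x) (hy : 0 < y) : (a * x + b * y) ^ q ≤ a * x ^ q + b * y ^ q := by
  calc (a * x + b * y) ^ q ≤ (x ^ a * y ^ b) ^ q :=
        Real.rpow_le_rpow_of_nonpos (by positivity)
          (Real.geom_mean_le_arith_mean2_weighted ha.le hb.le hx.le hy.le hab) hq.le
    _ = (x ^ q) ^ a * (y ^ q) ^ b := by
        rw [Real.mul_rpow (by positivity) (by positivity), ← Real.rpow_mul hx.le,
          ← Real.rpow_mul hy.le, ← Real.rpow_mul hx.le, ← Real.rpow_mul hy.le, mul_comm a,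
          mul_comm b]
    _ ≤ _ := Real.geom_mean_le_arith_mean2_weighted ha.le hb.le (by positivity) (by positivity) hab

/-- A Minkowski-type inequality for power means of positive random variables whose
distribution functions satisfy a weighted geometric mean inequality. -/
theorem powerMean_le_add {q ε : ℝ} (hq : q < 1) (hq0 : q ≠ 0) (hε : 0 < ε) {U V W : Ω → ℝ}
    (hU : Measurable U) (hV : Measurable V) (hW : Measurable W) (hUε : ∀ ω, ε ≤ U ω)
    (hVε : ∀ ω, ε ≤ V ω) (hWε : ∀ ω, ε ≤ W ω)
    (H : ∀ u v, 0 < u → 0 < v → P.real {ω | U ω ≤ u} ^ (u / (u + v)) *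
      P.real {ω | V ω ≤ v} ^ (v / (u + v)) ≤ P.real {ω | W ω ≤ u + v})
    (iU : Integrable (fun ω => U ω ^ q) P) (iV : Integrable (fun ω => V ω ^ q) P)
    (iW : Integrable (fun ω => W ω ^ q) P) :
    (∫ ω, W ω ^ q ∂P) ^ q⁻¹ ≤ (∫ ω, U ω ^ q ∂P) ^ q⁻¹ + (∫ ω, V ω ^ q ∂P) ^ q⁻¹ := by
  obtain ⟨a, b, ha, hb, hab, hneg, hpos⟩ := exists_weights_lintegral_rpow P hq hε hU hV hW hUε hVε
    (fun ω => hε.trans_le (hWε ω)) H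
  have integral_pos : ∀ X : Ω → ℝ, (∀ ω, ε ≤ X ω) → Integrable (fun ω => X ω ^ q) P →
      0 < ∫ ω, X ω ^ q ∂P := by
    intro X hX iX
    have h0 : ∀ ω, 0 < X ω ^ q := fun ω => Real.rpow_pos_of_pos (hε.trans_le (hX ω)) _
    rw [integral_pos_iff_support_of_nonneg (fun ω => (h0 ω).le) iX]
    have : Function.support (fun ω => X ω ^ q) = univ := by
      ext ω
      simpa using (h0 ω).ne'
    simp [this]
  have lint : ∀ (X : Ω → ℝ) (c : ℝ), 0 < c → (∀ ω, ε ≤ X ω) →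
      Integrable (fun ω => X ω ^ q) P → ENNReal.ofReal c *
      ∫⁻ ω, ENNReal.ofReal ((X ω / c) ^ q) ∂P = ENNReal.ofReal (c * ((∫ ω, X ω ^ q ∂P) / c ^ q)) := by
    intro X c hc hX iX
    have h0 : ∀ ω, 0 < X ω := fun ω => hε.trans_le (hX ω)
    simp_rw [fun ω => Real.div_rpow (h0 ω).le hc.le q]
    rw [← ofReal_integral_eq_lintegral_ofReal (iX.div_const _)
      (Filter.Eventually.of_forall fun ω => by have := h0 ω; positivity),
      integral_div, ← ENNReal.ofReal_mul hc.le]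
  have pU := integral_pos U hUε iU
  have pV := integral_pos V hVε iV
  have pW := integral_pos W hWε iW
  have lW : ∫⁻ ω, ENNReal.ofReal (W ω ^ q) ∂P = ENNReal.ofReal (∫ ω, W ω ^ q ∂P) :=
    (ofReal_integral_eq_lintegral_ofReal iW (Filter.Eventually.of_forall fun ω =>
      Real.rpow_nonneg (hε.le.trans (hWε ω)) _)).symm
  rw [lint U a ha hUε iU, lint V b hb hVε iV, ← ENNReal.ofReal_add (by positivity) (by positivity),
    lW] at hneg hpos
  set A := ∫ ω, U ω ^ q ∂P
  set B := ∫ ω, V ω ^ q ∂P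
  set C := ∫ ω, W ω ^ q ∂P
  have pow_inv : ∀ x c : ℝ, 0 < x → 0 < c → (x ^ q⁻¹ / c) ^ q = x / c ^ q := by
    intro x c hx hc
    rw [Real.div_rpow (by positivity) hc.le, ← Real.rpow_mul hx.le, inv_mul_cancel₀ hq0,
      Real.rpow_one]
  -- Written as a convex combination, the sum is open to convexity of `t^q` when `q < 0` and
  -- concavity when `0 < q < 1`.
  have hsum : A ^ q⁻¹ + B ^ q⁻¹ = a * (A ^ q⁻¹ / a) + b * (B ^ q⁻¹ / b) := by
    field_simp
  rw [hsum]
  have pX : 0 < A ^ q⁻¹ / a := by positivity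
  have pY : 0 < B ^ q⁻¹ / b := by positivity
  rcases lt_or_gt_of_ne hq0 with h | h
  · have h1 := (ENNReal.ofReal_le_ofReal_iff pW.le).1 (hneg h)
    rw [Real.rpow_inv_le_iff_of_neg pW (by positivity) h]
    refine (rpow_add_le_of_neg h ha hb hab pX pY).trans ?_
    rwa [pow_inv A a pU ha, pow_inv B b pV hb]
  · have h1 := (ENNReal.ofReal_le_ofReal_iff (by positivity)).1 (hpos h)
    rw [Real.rpow_inv_le_iff_of_pos pW.le (by positivity) h]
    refine h1.trans ?_
    rw [← pow_inv A a pU ha, ← pow_inv B b pV hb]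
    exact (Real.concaveOn_rpow h.le hq.le).2 pX.le pY.le ha.le hb.le hab

end Moments

/-! ### The covariogram and the gauges of translates -/

section Geometry

variable {n : ℕ} {K : Set (EuclideanSpace ℝ (Fin n))}

/-- The fraction of the volume of `K` that stays in `K` after translation by `x`. -/
noncomputable def translateOverlap (K : Set (EuclideanSpace ℝ (Fin n)))
    (x : EuclideanSpace ℝ (Fin n)) : ℝ :=
  volume.real (K ∩ {y | y + x ∈ K}) / volume.real K

theorem IsConvexBody.measurableSet (hK : IsConvexBody K) : MeasurableSet K :=
  hK.isCompact.measurableSet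

theorem IsConvexBody.volume_ne_top (hK : IsConvexBody K) : volume K ≠ ∞ :=
  hK.isCompact.measure_lt_top.ne

theorem IsConvexBody.volume_ne_zero (hK : IsConvexBody K) : volume K ≠ 0 :=
  (Measure.measure_pos_of_nonempty_interior _ hK.interior_nonempty).ne'

theorem IsConvexBody.volumeReal_pos (hK : IsConvexBody K) : 0 < volume.real K :=
  ENNReal.toReal_pos hK.volume_ne_zero hK.volume_ne_top

theorem measurableSet_translate (hK : IsConvexBody K) (x : EuclideanSpace ℝ (Fin n)) :
    MeasurableSet {y | y + x ∈ K} :=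
  hK.measurableSet.preimage (measurable_add_const x)

theorem translateOverlap_nonneg (x : EuclideanSpace ℝ (Fin n)) : 0 ≤ translateOverlap K x := by
  unfold translateOverlap
  positivity

theorem translateOverlap_le_one (hK : IsConvexBody K) (x : EuclideanSpace ℝ (Fin n)) :
    translateOverlap K x ≤ 1 :=
  div_le_one_of_le₀ (measureReal_mono inter_subset_left hK.volume_ne_top) measureReal_nonneg

theorem translateOverlap_zero (hK : IsConvexBody K) : translateOverlap K 0 = 1 := by
  have : K ∩ {y | y + 0 ∈ K} = K := by ext y; simp
  rw [translateOverlap, this, div_self hK.volumeReal_pos.ne']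

theorem translateOverlap_neg (x : EuclideanSpace ℝ (Fin n)) :
    translateOverlap K (-x) = translateOverlap K x := by
  unfold translateOverlap
  congr 1
  rw [measureReal_def, measureReal_def, ← measure_preimage_add_right volume x]
  congr 2
  ext y
  simp [and_comm]

/-- Prékopa–Leindler for the indicators of the sets `K ∩ (K - z)`: by convexity of `K`, the
combination of those for `x` and `y` lies in the one for `a • x + b • y`. -/
theorem translateOverlap_logConcave (hK : IsConvexBody K) {a b : ℝ} (ha : 0 < a) (hb : 0 < b)
    (hab : a + b = 1) (x y : EuclideanSpace ℝ (Fin n)) :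
    translateOverlap K x ^ a * translateOverlap K y ^ b ≤ translateOverlap K (a • x + b • y) := by
  have meas : ∀ z, MeasurableSet (K ∩ {y | y + z ∈ K}) := fun z =>
    hK.measurableSet.inter (measurableSet_translate hK z)
  have fin : ∀ z, volume (K ∩ {y | y + z ∈ K}) ≠ ∞ := fun z =>
    ne_top_of_le_ne_top hK.volume_ne_top (measure_mono inter_subset_left)
  have key := prekopaLeindler_euclideanSpace n a b ha hb hab
    ((K ∩ {w | w + x ∈ K}).indicator 1) ((K ∩ {w | w + y ∈ K}).indicator 1)
    ((K ∩ {w | w + (a • x + b • y) ∈ K}).indicator 1)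
    (measurable_one.indicator (meas _)) (measurable_one.indicator (meas _))
    (measurable_one.indicator (meas _)) (by
      intro z w
      by_cases hz : z ∈ K ∩ {w | w + x ∈ K}
      swap
      · simp [indicator_of_notMem hz, ha]
      by_cases hw : w ∈ K ∩ {w | w + y ∈ K}
      swap
      · simp [indicator_of_notMem hw, hb]
      have : a • z + b • w ∈ K ∩ {w | w + (a • x + b • y) ∈ K} := by
        refine ⟨hK.convex hz.1 hw.1 ha.le hb.le hab, ?_⟩
        have h := hK.convex hz.2 hw.2 ha.le hb.le hab
        have e : a • z + b • w + (a • x + b • y) = a • (z + x) + b • (w + y) := by module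
        rw [mem_ofPred_eq, e]
        exact h
      rw [indicator_of_mem hz, indicator_of_mem hw, indicator_of_mem this]
      simp)
  rw [lintegral_indicator_one (meas _), lintegral_indicator_one (meas _),
    lintegral_indicator_one (meas _)] at key
  have key' := ENNReal.toReal_mono (fin _) key
  rw [ENNReal.toReal_mul, ← ENNReal.toReal_rpow, ← ENNReal.toReal_rpow] at key'
  have hV := hK.volumeReal_pos
  unfold translateOverlap
  rw [Real.div_rpow measureReal_nonneg hV.le, Real.div_rpow measureReal_nonneg hV.le,
    div_mul_div_comm, ← Real.rpow_add hV, hab, Real.rpow_one]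
  exact div_le_div_of_nonneg_right key' hV.le

theorem exists_translateOverlap_pos (hK : IsConvexBody K) (x : EuclideanSpace ℝ (Fin n)) :
    ∃ δ : ℝ, 0 < δ ∧ 0 < translateOverlap K (δ • x) := by
  obtain ⟨z, hz⟩ := hK.interior_nonempty
  have hlim : Filter.Tendsto (fun δ : ℝ => z + δ • x) (nhdsWithin 0 (Ioi 0)) (nhds z) := by
    have : Continuous fun δ : ℝ => z + δ • x := by fun_prop
    simpa using (this.tendsto 0).mono_left nhdsWithin_le_nhds
  obtain ⟨δ, hδ, hδ0⟩ := ((hlim.eventually (isOpen_interior.mem_nhds hz)).and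
    self_mem_nhdsWithin).exists
  refine ⟨δ, hδ0, div_pos ?_ hK.volumeReal_pos⟩
  refine ENNReal.toReal_pos (Measure.measure_pos_of_nonempty_interior _ ⟨z, ?_⟩).ne'
    (ne_top_of_le_ne_top hK.volume_ne_top (measure_mono inter_subset_left))
  rw [interior_inter]
  refine ⟨hz, mem_interior.2 ⟨{y | y + δ • x ∈ interior K}, fun y hy => ?_, ?_, hδ⟩⟩
  · change y + δ • x ∈ K
    change y + δ • x ∈ interior K at hy
    exact interior_subset hy
  · exact isOpen_interior.preimage (by fun_prop)

/-- Log-concavity between `0`, where the overlap is 1, and `δ • x`, where it is `c > 0`, gives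
overlap at least `c^s ≥ 1 + s log c` at `s • δ • x` for `0 < s < 1`. This is the tail bound behind
moments of order `0 < q < 1`. -/
theorem exists_one_sub_translateOverlap_le (hK : IsConvexBody K) (x : EuclideanSpace ℝ (Fin n)) :
    ∃ C : ℝ, 0 ≤ C ∧ ∀ u : ℝ, 0 < u → 1 - translateOverlap K (u⁻¹ • x) ≤ C * u⁻¹ := by
  obtain ⟨δ, hδ, hpos⟩ := exists_translateOverlap_pos hK x
  set c := translateOverlap K (δ • x) with hc
  have hlog : Real.log c ≤ 0 := Real.log_nonpos hpos.le (translateOverlap_le_one hK _)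
  -- The summand `δ⁻¹` handles `u ≤ δ⁻¹`, where the trivial bound 1 suffices; the other is the
  -- log-concavity estimate.
  refine ⟨δ⁻¹ + -Real.log c * δ⁻¹, by have := neg_nonneg.2 hlog; positivity, fun u hu => ?_⟩
  have hu' : 0 < u⁻¹ := inv_pos.2 hu
  rcases le_or_gt 1 (δ⁻¹ * u⁻¹) with h | h
  · have h1 : 0 ≤ -Real.log c * δ⁻¹ * u⁻¹ := by have := neg_nonneg.2 hlog; positivity
    have := translateOverlap_nonneg (K := K) (u⁻¹ • x)
    rw [add_mul]
    linarith
  · set s := δ⁻¹ * u⁻¹ with hs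
    have hs0 : 0 < s := by positivity
    have key := translateOverlap_logConcave hK (a := 1 - s) (b := s) (by linarith) hs0 (by ring)
      0 (δ • x)
    have e : (1 - s) • (0 : EuclideanSpace ℝ (Fin n)) + s • δ • x = u⁻¹ • x := by
      rw [smul_zero, zero_add, smul_smul, hs]
      congr 1
      field_simp
    rw [translateOverlap_zero hK, Real.one_rpow, one_mul, e, Real.rpow_def_of_pos hpos] at key
    have h2 := Real.add_one_le_exp (Real.log c * s)
    have h3 : (δ⁻¹ + -Real.log c * δ⁻¹) * u⁻¹ = s - Real.log c * s := by rw [hs]; ring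
    rw [h3]
    linarith

theorem translate_image_eq (y : EuclideanSpace ℝ (Fin n)) :
    (fun z => z - y) '' K = {w | w + y ∈ K} := by
  ext w
  constructor
  · rintro ⟨z, hz, rfl⟩
    simpa using hz
  · intro hw
    exact ⟨w + y, hw, by simp⟩

theorem translate_mem_nhds_zero {y : EuclideanSpace ℝ (Fin n)} (hy : y ∈ interior K) :
    {w | w + y ∈ K} ∈ nhds (0 : EuclideanSpace ℝ (Fin n)) := by
  have : Continuous fun w : EuclideanSpace ℝ (Fin n) => w + y := by fun_prop
  exact this.continuousAt.preimage_mem_nhds (by simpa using mem_interior_iff_mem_nhds.1 hy)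

/-- `K - y` is closed and a neighbourhood of 0, so it is exactly the unit sublevel set of its gauge.
This links the gauge to the covariogram. -/
theorem translateGauge_le_iff (hK : IsConvexBody K) {y : EuclideanSpace ℝ (Fin n)}
    (hy : y ∈ interior K) (x : EuclideanSpace ℝ (Fin n)) {u : ℝ} (hu : 0 < u) :
    translateGauge K y x ≤ u ↔ y + u⁻¹ • x ∈ K := by
  unfold translateGauge
  rw [translate_image_eq]
  have hconv : Convex ℝ {w | w + y ∈ K} := by
    have := hK.convex.translate_preimage_left y
    exact this
  have hclosed : IsClosed {w | w + y ∈ K} := hK.isCompact.isClosed.preimage (by fun_prop)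
  have h := gauge_le_one_iff_mem_closure (x := u⁻¹ • x) hconv (translate_mem_nhds_zero hy)
  rw [hclosed.closure_eq, gauge_smul_of_nonneg (inv_nonneg.2 hu.le), smul_eq_mul,
    inv_mul_le_iff₀ hu, mul_one] at h
  rw [h, mem_ofPred_eq, add_comm]

/-- A positive upper bound for the diameter of `K`. -/
noncomputable def diamBound (K : Set (EuclideanSpace ℝ (Fin n))) : ℝ := Metric.diam K + 1

theorem diamBound_pos : 0 < diamBound K := by
  have := Metric.diam_nonneg (s := K)
  unfold diamBound
  linarith

theorem norm_div_le_translateGauge (hK : IsConvexBody K) {y : EuclideanSpace ℝ (Fin n)}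
    (hy : y ∈ interior K) (x : EuclideanSpace ℝ (Fin n)) :
    ‖x‖ / diamBound K ≤ translateGauge K y x := by
  unfold translateGauge
  rw [translate_image_eq]
  refine le_gauge_of_subset_closedBall (absorbent_nhds_zero (translate_mem_nhds_zero hy))
    diamBound_pos.le fun w hw => ?_
  rw [mem_closedBall_zero_iff]
  have h := Metric.dist_le_diam_of_mem hK.isCompact.isBounded hw (interior_subset hy)
  rw [dist_eq_norm, add_sub_cancel_right] at h
  unfold diamBound
  linarith

open Classical in
/-- The functional `translateGauge`, modified for `y` outside the interior of `K` so that it is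
bounded below by a multiple of the norm for all `y`. -/
noncomputable def interiorGauge (K : Set (EuclideanSpace ℝ (Fin n)))
    (x y : EuclideanSpace ℝ (Fin n)) : ℝ :=
  if y ∈ interior K then translateGauge K y x else ‖x‖ / diamBound K

theorem norm_div_le_interiorGauge (hK : IsConvexBody K) (x y : EuclideanSpace ℝ (Fin n)) :
    ‖x‖ / diamBound K ≤ interiorGauge K x y := by
  unfold interiorGauge
  split_ifs with hy
  · exact norm_div_le_translateGauge hK hy x
  · exact le_rfl

theorem norm_div_diamBound_pos {x : EuclideanSpace ℝ (Fin n)} (hx : x ≠ 0) :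
    0 < ‖x‖ / diamBound K :=
  div_pos (norm_pos_iff.2 hx) diamBound_pos

theorem interiorGauge_pos (hK : IsConvexBody K) {x : EuclideanSpace ℝ (Fin n)} (hx : x ≠ 0)
    (y : EuclideanSpace ℝ (Fin n)) : 0 < interiorGauge K x y :=
  (norm_div_diamBound_pos hx).trans_le (norm_div_le_interiorGauge hK x y)

theorem interiorGauge_smul {c : ℝ} (hc : 0 ≤ c) (x y : EuclideanSpace ℝ (Fin n)) :
    interiorGauge K (c • x) y = c * interiorGauge K x y := by
  unfold interiorGauge translateGauge
  split_ifs with hy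
  · rw [gauge_smul_of_nonneg hc, smul_eq_mul]
  · rw [norm_smul, Real.norm_of_nonneg hc, mul_div_assoc]

theorem measurable_interiorGauge (hK : IsConvexBody K) {x : EuclideanSpace ℝ (Fin n)}
    (hx : x ≠ 0) : Measurable (interiorGauge K x) := by
  refine measurable_of_Iic fun u => ?_
  by_cases hu : 0 < u
  · have : interiorGauge K x ⁻¹' Iic u = (interior K ∩ {y | y + u⁻¹ • x ∈ K}) ∪
        ((interior K)ᶜ ∩ {_y | ‖x‖ / diamBound K ≤ u}) := by
      ext y
      by_cases hy : y ∈ interior K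
      · simp [interiorGauge, hy, translateGauge_le_iff hK hy x hu]
      · simp [interiorGauge, hy]
    rw [this]
    exact (isOpen_interior.measurableSet.inter (measurableSet_translate hK _)).union
      (isOpen_interior.measurableSet.compl.inter (MeasurableSet.const _))
  · have : interiorGauge K x ⁻¹' Iic u = ∅ := by
      ext y
      simp only [mem_preimage, mem_Iic, mem_empty_iff_false, iff_false, not_le]
      exact (not_lt.1 hu).trans_lt (interiorGauge_pos hK hx y)
    rw [this]
    exact MeasurableSet.empty

/-- The uniform probability measure on `K`. -/
noncomputable def uniformOn (K : Set (EuclideanSpace ℝ (Fin n))) :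
    Measure (EuclideanSpace ℝ (Fin n)) :=
  (volume K)⁻¹ • volume.restrict K

theorem isProbabilityMeasure_uniformOn (hK : IsConvexBody K) :
    IsProbabilityMeasure (uniformOn K) := by
  constructor
  rw [uniformOn, Measure.smul_apply, Measure.restrict_apply_univ, smul_eq_mul,
    ENNReal.inv_mul_cancel hK.volume_ne_zero hK.volume_ne_top]

theorem ae_restrict_mem_interior (hK : IsConvexBody K) :
    ∀ᵐ y ∂volume.restrict K, y ∈ interior K := by
  rw [ae_restrict_iff' hK.measurableSet]
  have h0 : volume (frontier K) = 0 := hK.convex.addHaar_frontier volume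
  filter_upwards [measure_eq_zero_iff_ae_notMem.1 h0] with y hy hyK
  by_contra h
  exact hy ⟨subset_closure hyK, h⟩

theorem integral_uniformOn (f : EuclideanSpace ℝ (Fin n) → ℝ) :
    ∫ y, f y ∂uniformOn K = (∫ y in K, f y) / volume.real K := by
  rw [uniformOn, integral_smul_measure, ENNReal.toReal_inv, smul_eq_mul, inv_mul_eq_div,
    measureReal_def]

theorem integrable_uniformOn_iff (hK : IsConvexBody K) (f : EuclideanSpace ℝ (Fin n) → ℝ) :
    Integrable f (uniformOn K) ↔ IntegrableOn f K := by
  rw [uniformOn, IntegrableOn, integrable_smul_measure (ENNReal.inv_ne_zero.2 hK.volume_ne_top)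
    (ENNReal.inv_ne_top.2 hK.volume_ne_zero)]

theorem uniformOn_real_interiorGauge_le (hK : IsConvexBody K) (x : EuclideanSpace ℝ (Fin n))
    {u : ℝ} (hu : 0 < u) :
    (uniformOn K).real {y | interiorGauge K x y ≤ u} = translateOverlap K (u⁻¹ • x) := by
  have h : volume.restrict K {y | interiorGauge K x y ≤ u}
      = volume (K ∩ {y | y + u⁻¹ • x ∈ K}) := by
    rw [inter_comm, ← Measure.restrict_apply (measurableSet_translate hK _)]
    refine measure_congr ?_
    filter_upwards [ae_restrict_mem_interior hK] with y hy
    refine propext ?_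
    change interiorGauge K x y ≤ u ↔ y + u⁻¹ • x ∈ K
    rw [interiorGauge, if_pos hy, translateGauge_le_iff hK hy x hu]
  rw [measureReal_def, uniformOn, Measure.smul_apply, h, smul_eq_mul, ENNReal.toReal_mul,
    ENNReal.toReal_inv, inv_mul_eq_div]
  rfl

/-- The law of the gauge is determined by the covariogram, which is even. Symmetry holds only in
law, not pointwise in `y`. -/
theorem map_interiorGauge_neg (hK : IsConvexBody K) {x : EuclideanSpace ℝ (Fin n)} (hx : x ≠ 0) :
    (uniformOn K).map (interiorGauge K (-x)) = (uniformOn K).map (interiorGauge K x) := by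
  have := isProbabilityMeasure_uniformOn hK
  have hm := measurable_interiorGauge hK hx
  have hm' := measurable_interiorGauge hK (neg_ne_zero.2 hx)
  have : IsFiniteMeasure ((uniformOn K).map (interiorGauge K (-x))) :=
    Measure.isFiniteMeasure_map _ _
  refine Measure.ext_of_Iic _ _ fun u => ?_
  rw [Measure.map_apply hm measurableSet_Iic, Measure.map_apply hm' measurableSet_Iic]
  by_cases hu : 0 < u
  · have h := uniformOn_real_interiorGauge_le hK (-x) hu
    rw [smul_neg, translateOverlap_neg, ← uniformOn_real_interiorGauge_le hK x hu] at h
    exact (measureReal_eq_measureReal_iff).1 h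
  · have : ∀ z : EuclideanSpace ℝ (Fin n), z ≠ 0 → interiorGauge K z ⁻¹' Iic u = ∅ := by
      intro z hz
      ext y
      simp only [mem_preimage, mem_Iic, mem_empty_iff_false, iff_false, not_le]
      exact (not_lt.1 hu).trans_lt (interiorGauge_pos hK hz y)
    rw [this x hx, this (-x) (neg_ne_zero.2 hx)]

theorem interiorGauge_cdf_add (hK : IsConvexBody K) (x y : EuclideanSpace ℝ (Fin n)) (u v : ℝ)
    (hu : 0 < u) (hv : 0 < v) :
    (uniformOn K).real {z | interiorGauge K x z ≤ u} ^ (u / (u + v)) *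
      (uniformOn K).real {z | interiorGauge K y z ≤ v} ^ (v / (u + v))
      ≤ (uniformOn K).real {z | interiorGauge K (x + y) z ≤ u + v} := by
  have hw : 0 < u + v := add_pos hu hv
  rw [uniformOn_real_interiorGauge_le hK x hu, uniformOn_real_interiorGauge_le hK y hv,
    uniformOn_real_interiorGauge_le hK (x + y) hw]
  refine (translateOverlap_logConcave hK (div_pos hu hw) (div_pos hv hw) (by field_simp)
    _ _).trans_eq ?_
  congr 1
  rw [smul_smul, smul_smul, smul_add]
  congr 2 <;> field_simp

/-- The integrand is dominated by `u^(q-1)` near 0, integrable as `q > 0`, and by `C u^(q-2)` at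
infinity, integrable as `q < 1`. -/
theorem lintegral_rpowWeighted_lt_top {q C : ℝ} (hq0 : 0 < q) (hq : q < 1) {F : ℝ → ℝ}
    (hF1 : ∀ u, F u ≤ 1) (hFC : ∀ u, 0 < u → F u ≤ C * u⁻¹) :
    ∫⁻ u, ENNReal.ofReal (rpowWeighted q F u) < ∞ := by
  have i₁ : Integrable ((Ioc (0 : ℝ) 1).indicator fun u => u ^ (q - 1)) := by
    rw [integrable_indicator_iff measurableSet_Ioc,
      ← intervalIntegrable_iff_integrableOn_Ioc_of_le zero_le_one]
    exact intervalIntegral.intervalIntegrable_rpow' (by linarith)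
  have i₂ : Integrable ((Ioi (1 : ℝ)).indicator fun u => C * u ^ (q - 2)) := by
    rw [integrable_indicator_iff measurableSet_Ioi]
    exact (integrableOn_Ioi_rpow_of_lt (by linarith) one_pos).const_mul C
  refine lt_of_le_of_lt (lintegral_mono fun u => ENNReal.ofReal_le_ofReal ?_)
    (i₁.add i₂).lintegral_lt_top
  simp only [Pi.add_apply, rpowWeighted]
  split_ifs with hu
  · rcases le_or_gt u 1 with h | h
    · rw [indicator_of_mem (show u ∈ Ioc 0 1 from ⟨hu, h⟩), indicator_of_notMem (by simpa using h),
        add_zero]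
      exact mul_le_of_le_one_right (Real.rpow_nonneg hu.le _) (hF1 u)
    · rw [indicator_of_mem (mem_Ioi.2 h), indicator_of_notMem (fun h' => h.not_ge h'.2), zero_add]
      calc u ^ (q - 1) * F u ≤ u ^ (q - 1) * (C * u⁻¹) := by gcongr; exact hFC u hu
        _ = C * u ^ (q - 2) := by
          rw [show q - 2 = q - 1 + -1 by ring, Real.rpow_add hu, Real.rpow_neg_one]
          ring
  · rw [indicator_of_notMem (fun h => hu h.1),
      indicator_of_notMem (s := Ioi (1 : ℝ)) (fun h => hu (one_pos.trans (mem_Ioi.1 h))), add_zero]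

theorem integrable_interiorGauge_rpow (hK : IsConvexBody K) {x : EuclideanSpace ℝ (Fin n)}
    (hx : x ≠ 0) {q : ℝ} (hq : q < 1) :
    Integrable (fun y => interiorGauge K x y ^ q) (uniformOn K) := by
  have := isProbabilityMeasure_uniformOn hK
  have hm := measurable_interiorGauge hK hx
  have hpos := interiorGauge_pos hK hx
  have hmq : Measurable fun y => interiorGauge K x y ^ q := by fun_prop
  rcases le_or_gt q 0 with hq0 | hq0
  · refine Integrable.of_bound hmq.aestronglyMeasurable ((‖x‖ / diamBound K) ^ q)
      (Filter.Eventually.of_forall fun y => ?_)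
    rw [Real.norm_of_nonneg (Real.rpow_nonneg (hpos y).le _)]
    exact Real.rpow_le_rpow_of_nonpos (norm_div_diamBound_pos hx)
      (norm_div_le_interiorGauge hK x y) hq0
  · refine ⟨hmq.aestronglyMeasurable, ?_⟩
    rw [hasFiniteIntegral_iff_ofReal (Filter.Eventually.of_forall fun y =>
      Real.rpow_nonneg (hpos y).le _), lintegral_rpow_of_pos _ hq0 hm hpos]
    obtain ⟨C, hC, hCu⟩ := exists_one_sub_translateOverlap_le hK x
    refine ENNReal.mul_lt_top ENNReal.ofReal_lt_top
      (lintegral_rpowWeighted_lt_top (C := C) hq0 hq (fun u => ?_) fun u hu => ?_)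
    · have := measureReal_nonneg (μ := uniformOn K) (s := {y | interiorGauge K x y ≤ u})
      linarith
    · rw [uniformOn_real_interiorGauge_le hK x hu]
      exact hCu u hu

end Geometry

/-! ### From a sublinear functional to its unit ball -/

section Norm

variable {n : ℕ}

theorem gauge_setOf_le_one {N : EuclideanSpace ℝ (Fin n) → ℝ} (h0 : N 0 = 0)
    (hpos : ∀ x, x ≠ 0 → 0 < N x) (hsmul : ∀ c : ℝ, 0 < c → ∀ x, N (c • x) = c * N x)
    (x : EuclideanSpace ℝ (Fin n)) : gauge {y | N y ≤ 1} x = N x := by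
  rcases eq_or_ne x 0 with rfl | hx
  · rw [gauge_zero, h0]
  have : {r ∈ Ioi (0 : ℝ) | r⁻¹ • x ∈ {y | N y ≤ 1}} = Ici (N x) := by
    ext r
    constructor
    · rintro ⟨hr, h⟩
      rw [mem_ofPred_eq, hsmul _ (inv_pos.2 hr), inv_mul_le_iff₀ hr, mul_one] at h
      exact h
    · intro h
      have hr : 0 < r := (hpos x hx).trans_le h
      refine ⟨hr, ?_⟩
      rw [mem_ofPred_eq, hsmul _ (inv_pos.2 hr), inv_mul_le_iff₀ hr, mul_one]
      exact h
  rw [gauge_def', this, csInf_Ici]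

/-- Sublinearity makes `N` convex, and a finite convex function on a finite-dimensional space is
continuous; so the ball is closed and has 0 in its interior. The lower bound on `N` makes it
bounded. -/
theorem isConvexBody_setOf_le_one {N : EuclideanSpace ℝ (Fin n) → ℝ} {R : ℝ} (hR : 0 < R)
    (h0 : N 0 = 0) (hsmul : ∀ c : ℝ, 0 < c → ∀ x, N (c • x) = c * N x)
    (hadd : ∀ x y, N (x + y) ≤ N x + N y) (hle : ∀ x, ‖x‖ / R ≤ N x) :
    IsConvexBody {x | N x ≤ 1} := by
  have hsmul' : ∀ c : ℝ, 0 ≤ c → ∀ x, N (c • x) = c * N x := by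
    intro c hc x
    rcases hc.eq_or_lt with rfl | hc
    · rw [zero_smul, zero_mul, h0]
    · exact hsmul c hc x
  have hconv : ConvexOn ℝ univ N := by
    refine ⟨convex_univ, fun x _ y _ a b ha hb _ => ?_⟩
    rw [smul_eq_mul, smul_eq_mul, ← hsmul' a ha, ← hsmul' b hb]
    exact hadd _ _
  have hcont : Continuous N := by
    rw [← continuousOn_univ]
    exact hconv.continuousOn isOpen_univ
  refine ⟨?_, ?_, ?_⟩
  · refine Metric.isCompact_of_isClosed_isBounded (isClosed_le hcont continuous_const) ?_
    refine (Metric.isBounded_closedBall (x := (0 : EuclideanSpace ℝ (Fin n))) (r := R)).subset ?_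
    intro x hx
    rw [mem_closedBall_zero_iff]
    have := (hle x).trans hx
    rwa [div_le_one hR] at this
  · have := hconv.convex_le 1
    simpa using this
  · refine ⟨0, mem_interior.2 ⟨{x | N x < 1}, fun x (hx : N x < 1) => show N x ≤ 1 from hx.le,
      isOpen_lt hcont continuous_const, ?_⟩⟩
    rw [mem_ofPred_eq, h0]
    exact one_pos

end Norm

/-! ### Power means of the gauge -/

section RadialMean

variable {n : ℕ} {K : Set (EuclideanSpace ℝ (Fin n))}

/-- The exponential moments of the logarithm are the power moments of the gauge, finite for every
order `t < 1`, hence on a neighbourhood of 0. -/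
theorem integrable_log_interiorGauge (hK : IsConvexBody K) {x : EuclideanSpace ℝ (Fin n)}
    (hx : x ≠ 0) : Integrable (fun y => Real.log (interiorGauge K x y)) (uniformOn K) ∧
      0 ∈ interior (ProbabilityTheory.integrableExpSet
        (fun y => Real.log (interiorGauge K x y)) (uniformOn K)) := by
  have hmem : 0 ∈ interior (ProbabilityTheory.integrableExpSet
      (fun y => Real.log (interiorGauge K x y)) (uniformOn K)) := by
    refine mem_interior.2 ⟨Iio 1, fun t ht => ?_, isOpen_Iio, by simp⟩
    refine (integrable_interiorGauge_rpow hK hx ht).congr (Filter.Eventually.of_forall fun y => ?_)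
    dsimp only
    rw [Real.rpow_def_of_pos (interiorGauge_pos hK hx y), mul_comm]
  exact ⟨ProbabilityTheory.integrable_of_mem_interior_integrableExpSet hmem, hmem⟩

/-- The power mean of order `q` of `interiorGauge K x` over `K`. -/
noncomputable def gaugeMean (q : ℝ) (K : Set (EuclideanSpace ℝ (Fin n)))
    (x : EuclideanSpace ℝ (Fin n)) : ℝ :=
  if q = 0 then Real.exp (∫ y, Real.log (interiorGauge K x y) ∂uniformOn K)
  else (∫ y, interiorGauge K x y ^ q ∂uniformOn K) ^ q⁻¹

theorem radialMeanIntegrand_ae_eq (hK : IsConvexBody K) (p : ℝ) (x : EuclideanSpace ℝ (Fin n)) :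
    radialMeanIntegrand p K x =ᵐ[volume.restrict K] fun y =>
      if p = 0 then Real.log (interiorGauge K x y) else interiorGauge K x y ^ (-p) := by
  filter_upwards [ae_restrict_mem_interior hK] with y hy
  simp [radialMeanIntegrand, interiorGauge, hy]

theorem integrableOn_radialMeanIntegrand (hK : IsConvexBody K) {p : ℝ} (hp : -1 < p)
    {x : EuclideanSpace ℝ (Fin n)} (hx : x ≠ 0) : IntegrableOn (radialMeanIntegrand p K x) K := by
  refine Integrable.congr ?_ (radialMeanIntegrand_ae_eq hK p x).symm
  rw [← IntegrableOn, ← integrable_uniformOn_iff hK]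
  split_ifs with h
  · exact (integrable_log_interiorGauge hK hx).1
  · exact integrable_interiorGauge_rpow hK hx (by linarith)

theorem radialMeanFunctional_eq_gaugeMean (hK : IsConvexBody K) (p : ℝ)
    {x : EuclideanSpace ℝ (Fin n)} (hx : x ≠ 0) :
    radialMeanFunctional p K x = gaugeMean (-p) K x := by
  rw [radialMeanFunctional, if_neg hx, gaugeMean,
    integral_congr_ae (radialMeanIntegrand_ae_eq hK p x)]
  by_cases hp : p = 0
  · simp [hp, integral_uniformOn]
  · simp [hp, integral_uniformOn, inv_neg]

theorem integral_interiorGauge_rpow_pos (hK : IsConvexBody K) {x : EuclideanSpace ℝ (Fin n)}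
    (hx : x ≠ 0) {q : ℝ} (hq : q < 1) : 0 < ∫ y, interiorGauge K x y ^ q ∂uniformOn K := by
  have := isProbabilityMeasure_uniformOn hK
  have h0 : ∀ y, 0 < interiorGauge K x y ^ q := fun y =>
    Real.rpow_pos_of_pos (interiorGauge_pos hK hx y) _
  rw [integral_pos_iff_support_of_nonneg (fun y => (h0 y).le)
    (integrable_interiorGauge_rpow hK hx hq)]
  have : Function.support (fun y => interiorGauge K x y ^ q) = univ := by
    ext y
    simpa using (h0 y).ne'
  simp [this]

theorem gaugeMean_smul (hK : IsConvexBody K) {q c : ℝ} (hc : 0 < c)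
    {x : EuclideanSpace ℝ (Fin n)} (hx : x ≠ 0) : gaugeMean q K (c • x) = c * gaugeMean q K x := by
  have := isProbabilityMeasure_uniformOn hK
  have hpos := interiorGauge_pos hK hx
  unfold gaugeMean
  simp_rw [interiorGauge_smul hc.le]
  split_ifs with hq
  · simp_rw [fun y => Real.log_mul hc.ne' (hpos y).ne']
    rw [integral_add (integrable_const _) (integrable_log_interiorGauge hK hx).1, integral_const,
      probReal_univ, one_smul, Real.exp_add, Real.exp_log hc]
  · simp_rw [fun y => Real.mul_rpow (z := q) hc.le (hpos y).le]
    rw [integral_const_mul, Real.mul_rpow (by positivity)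
      (integral_nonneg fun y => Real.rpow_nonneg (hpos y).le _), ← Real.rpow_mul hc.le,
      mul_inv_cancel₀ hq, Real.rpow_one]

theorem gaugeMean_neg (hK : IsConvexBody K) (q : ℝ) {x : EuclideanSpace ℝ (Fin n)} (hx : x ≠ 0) :
    gaugeMean q K (-x) = gaugeMean q K x := by
  have hm := measurable_interiorGauge hK hx
  have hm' := measurable_interiorGauge hK (neg_ne_zero.2 hx)
  have h : ∀ g : ℝ → ℝ, Measurable g → ∫ y, g (interiorGauge K (-x) y) ∂uniformOn K
      = ∫ y, g (interiorGauge K x y) ∂uniformOn K := by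
    intro g hg
    rw [← integral_map hm.aemeasurable hg.aestronglyMeasurable,
      ← integral_map hm'.aemeasurable hg.aestronglyMeasurable, map_interiorGauge_neg hK hx]
  unfold gaugeMean
  rw [h Real.log Real.measurable_log, h (fun u => u ^ q) (by fun_prop)]

theorem norm_div_le_gaugeMean (hK : IsConvexBody K) {q : ℝ} (hq : q < 1)
    {x : EuclideanSpace ℝ (Fin n)} (hx : x ≠ 0) : ‖x‖ / diamBound K ≤ gaugeMean q K x := by
  have := isProbabilityMeasure_uniformOn hK
  have hε := norm_div_diamBound_pos (K := K) hx
  have hle := norm_div_le_interiorGauge hK x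
  set ε := ‖x‖ / diamBound K
  have hint := integrable_interiorGauge_rpow hK hx hq
  have hI := integral_interiorGauge_rpow_pos hK hx hq
  unfold gaugeMean
  split_ifs with h0
  · rw [← Real.log_le_iff_le_exp hε]
    calc Real.log ε = ∫ _y, Real.log ε ∂uniformOn K := by simp
      _ ≤ _ := integral_mono (integrable_const _) (integrable_log_interiorGauge hK hx).1
        fun y => Real.log_le_log hε (hle y)
  · rcases lt_or_gt_of_ne h0 with h | h
    · rw [Real.le_rpow_inv_iff_of_neg hε hI h]
      calc _ ≤ ∫ _y, ε ^ q ∂uniformOn K := integral_mono hint (integrable_const _)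
            fun y => Real.rpow_le_rpow_of_nonpos hε (hle y) h.le
        _ = ε ^ q := by simp
    · rw [Real.le_rpow_inv_iff_of_pos hε.le hI.le h]
      calc ε ^ q = ∫ _y, ε ^ q ∂uniformOn K := by simp
        _ ≤ _ := integral_mono (integrable_const _) hint
            fun y => Real.rpow_le_rpow hε.le (hle y) h.le

/-- For `q ≠ 0` near 0, the logarithm of the power mean is `cgf q / q`, the slope at 0 of the
cumulant generating function of the log-gauge, whose derivative there is the mean. -/
theorem tendsto_gaugeMean (hK : IsConvexBody K) {x : EuclideanSpace ℝ (Fin n)} (hx : x ≠ 0) :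
    Filter.Tendsto (fun q => gaugeMean q K x) (nhdsWithin 0 {0}ᶜ) (nhds (gaugeMean 0 K x)) := by
  have := isProbabilityMeasure_uniformOn hK
  set X := fun y => Real.log (interiorGauge K x y) with hX
  have hmem := (integrable_log_interiorGauge hK hx).2
  have hd : HasDerivAt (ProbabilityTheory.cgf X (uniformOn K)) (∫ y, X y ∂uniformOn K) 0 := by
    have h := ProbabilityTheory.deriv_cgf_zero hmem
    rw [probReal_univ, div_one] at h
    rw [← h]
    exact (ProbabilityTheory.analyticAt_cgf hmem).differentiableAt.hasDerivAt
  have hslope := (hasDerivAt_iff_tendsto_slope.1 hd)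
  have hexp := (Real.continuous_exp.tendsto _).comp hslope
  have e0 : gaugeMean 0 K x = Real.exp (∫ y, X y ∂uniformOn K) := by simp [gaugeMean, hX]
  rw [e0]
  refine hexp.congr' ?_
  have h1 : ∀ᶠ q : ℝ in nhdsWithin 0 {0}ᶜ, q < 1 :=
    nhdsWithin_le_nhds (Iio_mem_nhds one_pos)
  filter_upwards [h1, self_mem_nhdsWithin] with q hq1 hq0
  have hq0' : q ≠ 0 := hq0
  have hmgf : ProbabilityTheory.mgf X (uniformOn K) q
      = ∫ y, interiorGauge K x y ^ q ∂uniformOn K := by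
    rw [ProbabilityTheory.mgf]
    refine integral_congr_ae (Filter.Eventually.of_forall fun y => ?_)
    dsimp only [hX]
    rw [Real.rpow_def_of_pos (interiorGauge_pos hK hx y), mul_comm]
  rw [Function.comp_apply, slope_def_field, ProbabilityTheory.cgf_zero, sub_zero, sub_zero,
    ProbabilityTheory.cgf, hmgf, gaugeMean, if_neg hq0',
    Real.rpow_def_of_pos (integral_interiorGauge_rpow_pos hK hx hq1), div_eq_mul_inv]

theorem gaugeMean_add_le (hK : IsConvexBody K) {q : ℝ} (hq : q < 1)
    {x y : EuclideanSpace ℝ (Fin n)} (hx : x ≠ 0) (hy : y ≠ 0) (hxy : x + y ≠ 0) :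
    gaugeMean q K (x + y) ≤ gaugeMean q K x + gaugeMean q K y := by
  have := isProbabilityMeasure_uniformOn hK
  have hne : ∀ q : ℝ, q < 1 → q ≠ 0 →
      gaugeMean q K (x + y) ≤ gaugeMean q K x + gaugeMean q K y := by
    intro q hq hq0
    simp only [gaugeMean, if_neg hq0]
    have hε : 0 < min (min (‖x‖ / diamBound K) (‖y‖ / diamBound K)) (‖x + y‖ / diamBound K) :=
      lt_min (lt_min (norm_div_diamBound_pos hx) (norm_div_diamBound_pos hy))
        (norm_div_diamBound_pos hxy)
    exact powerMean_le_add (uniformOn K) hq hq0 hε (measurable_interiorGauge hK hx)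
      (measurable_interiorGauge hK hy) (measurable_interiorGauge hK hxy)
      (fun z => ((min_le_left _ _).trans (min_le_left _ _)).trans (norm_div_le_interiorGauge hK x z))
      (fun z => ((min_le_left _ _).trans (min_le_right _ _)).trans
        (norm_div_le_interiorGauge hK y z))
      (fun z => (min_le_right _ _).trans (norm_div_le_interiorGauge hK (x + y) z))
      (interiorGauge_cdf_add hK x y) (integrable_interiorGauge_rpow hK hx hq)
      (integrable_interiorGauge_rpow hK hy hq) (integrable_interiorGauge_rpow hK hxy hq)
  rcases eq_or_ne q 0 with rfl | hq0
  -- The geometric mean inherits the triangle inequality from orders `q → 0`, `q ≠ 0`.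
  · refine le_of_tendsto_of_tendsto (tendsto_gaugeMean hK hxy)
      ((tendsto_gaugeMean hK hx).add (tendsto_gaugeMean hK hy)) ?_
    have h1 : ∀ᶠ q : ℝ in nhdsWithin 0 {0}ᶜ, q < 1 :=
      nhdsWithin_le_nhds (Iio_mem_nhds one_pos)
    filter_upwards [h1, self_mem_nhdsWithin] with q hq1 hq0
    exact hne q hq1 hq0
  · exact hne q hq hq0

end RadialMean

/-- For every convex body `K` and every real `p > -1`, the integrals defining `R_p K` converge, the
functional they define is the Minkowski functional of `R_p K`, and `R_p K` is a convex body that is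
symmetric about the origin. -/
theorem theorem1p3 (n : ℕ) (K : Set (EuclideanSpace ℝ (Fin n))) (hK : IsConvexBody K)
    (p : ℝ) (hp : -1 < p) :
    (∀ x : EuclideanSpace ℝ (Fin n), x ≠ 0 → IntegrableOn (radialMeanIntegrand p K x) K) ∧
    (∀ x : EuclideanSpace ℝ (Fin n),
      gauge (radialMeanBody p K) x = radialMeanFunctional p K x) ∧
    IsConvexBody (radialMeanBody p K) ∧
    (∀ x ∈ radialMeanBody p K, -x ∈ radialMeanBody p K) := by
  have hq : -p < 1 := by linarith
  have h0 : radialMeanFunctional p K 0 = 0 := by simp [radialMeanFunctional]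
  have hle : ∀ x, ‖x‖ / diamBound K ≤ radialMeanFunctional p K x := by
    intro x
    rcases eq_or_ne x 0 with rfl | hx
    · simp [h0]
    · rw [radialMeanFunctional_eq_gaugeMean hK p hx]
      exact norm_div_le_gaugeMean hK hq hx
  have hpos : ∀ x, x ≠ 0 → 0 < radialMeanFunctional p K x := fun x hx =>
    (norm_div_diamBound_pos hx).trans_le (hle x)
  have hnonneg : ∀ x, 0 ≤ radialMeanFunctional p K x := fun x =>
    (div_nonneg (norm_nonneg x) diamBound_pos.le).trans (hle x)
  have hsmul : ∀ c : ℝ, 0 < c → ∀ x, radialMeanFunctional p K (c • x)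
      = c * radialMeanFunctional p K x := by
    intro c hc x
    rcases eq_or_ne x 0 with rfl | hx
    · rw [smul_zero, h0, mul_zero]
    · rw [radialMeanFunctional_eq_gaugeMean hK p hx,
        radialMeanFunctional_eq_gaugeMean hK p (smul_ne_zero hc.ne' hx), gaugeMean_smul hK hc hx]
  have hadd : ∀ x y, radialMeanFunctional p K (x + y)
      ≤ radialMeanFunctional p K x + radialMeanFunctional p K y := by
    intro x y
    rcases eq_or_ne x 0 with rfl | hx
    · rw [zero_add, h0, zero_add]
    rcases eq_or_ne y 0 with rfl | hy
    · rw [add_zero, h0, add_zero]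
    rcases eq_or_ne (x + y) 0 with hxy | hxy
    · rw [hxy, h0]
      exact add_nonneg (hnonneg x) (hnonneg y)
    · rw [radialMeanFunctional_eq_gaugeMean hK p hx, radialMeanFunctional_eq_gaugeMean hK p hy,
        radialMeanFunctional_eq_gaugeMean hK p hxy]
      exact gaugeMean_add_le hK hq hx hy hxy
  refine ⟨fun x hx => integrableOn_radialMeanIntegrand hK hp hx,
    gauge_setOf_le_one h0 hpos hsmul, isConvexBody_setOf_le_one diamBound_pos h0 hsmul hadd hle,
    fun x hx => ?_⟩
  rcases eq_or_ne x 0 with rfl | hx0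
  · rwa [neg_zero]
  · change radialMeanFunctional p K (-x) ≤ 1
    rw [radialMeanFunctional_eq_gaugeMean hK p (neg_ne_zero.2 hx0), gaugeMean_neg hK _ hx0,
      ← radialMeanFunctional_eq_gaugeMean hK p hx0]
    exact hx
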